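/- Let $\mathcal X,\mathcal Y$ be finite sets, $\mathcal Z$ a set, $f\colon \mathcal X\times\mathcal Y\to\mathcal Z$ a function, and $\mu$ a probability measure on $\mathcal X\times\mathcal Y$. In a two-party communication protocol $\pi$, Alice holds $x\in\mathcal X$, Bob holds $y\in\mathcal Y$, and there are three independent random strings with arbitrary distributions: a public one and a private one for each player. As a function of the public string and the bits transmitted so far, the protocol specifies whether the communication is over and, if not, who sends the next bit; that bit is a function of the public string, the bits transmitted so far, the sender's input and the sender's private string. The number of transmitted bits is bounded, and on termination the output $\pi(x,y)$ is a function of the transcript $\Pi$, which consists of the public string and the transmitted bits. The (internal) information cost of $\pi$ is $\mathrm{IC}_\mu(\pi)=I(\Pi;X|Y)+I(\Pi;Y|X)$, measured in bits, where $(X,Y)\sim\mu$ is independent of the random strings. For $\epsilon\ge 0$ let $$\mathrm{IC}_\mu(f,\epsilon)=\inf\{\mathrm{IC}_\mu(\pi) : \Pr[\pi(x,y)\ne f(x,y)]\le\epsilon \text{ for every } (x,y)\in\mathcal X\times\mathcal Y\},$$ and let $h(\epsilon)=-\epsilon\log_2\epsilon-(1-\epsilon)\log_2(1-\epsilon)$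 be the binary entropy. Write $\mu(x,y)$ for the mass of a point and $\operatorname{supp}\mu$ for the set of points of positive mass. **Theorem.** Suppose that $\mathrm{IC}_\mu(f,0)>0$. Then there are constants $\tau,\epsilon_0>0$, depending on $f$ and $\mu$, such that for every $0\le\epsilon\le\epsilon_0$, $$\mathrm{IC}_\mu(f,\epsilon)\le\mathrm{IC}_\mu(f,0)-\tau\, h(\epsilon).$$ Moreover: - **Non-constant case.** If $a,b\in\operatorname{supp}\mu$ lie in the same row or the same column and $f(a)\ne f(b)$, then this holds with some $\tau\ge\mu(a)^2\mu(b)/64$ and with an $\epsilon_0>0$ that depends only on $\min(\mu(a),\mu(b))$ and $|\mathcal X\times\mathcal Y|$. - **AND case.** If $x_0,x_1\in\mathcal X$ and $y_0,y_1\in\mathcal Y$ satisfy $f(x_0,y_0)=f(x_0,y_1)=f(x_1,y_0)=z_0$ and $f(x_1,y_1)=z_1\ne z_0$, and $(x_0,y_0),(x_0,y_1),(x_1,y_0)\in\operatorname{supp}\mu$, then this holds with some $\tau\ge\frac{\mu(x_0,y_0)^2}{128}\min(\mu(x_0,y_1),\mu(x_1,y_0))$ and with an $\epsilon_0>0$ that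 depends only on $|\mathcal X\times\mathcal Y|$ and $\min(\mu(x_0,y_0),\mu(x_0,y_1),\mu(x_1,y_0))$. -/

import Mathlib

open MeasureTheory

universe u v w

noncomputable section

namespace CommInfo

/-- The binary entropy function, in bits. -/
def h (p : ℝ) : ℝ := Real.binEntropy p / Real.log 2

/-- The conditional entropy `H(A | 𝒢)`, in bits, of a random variable `A` with finitely many
values given a sub-σ-algebra `𝒢`: the expectation of
`∑ a, - Pr[A = a | 𝒢] * log₂ Pr[A = a | 𝒢]`.  Conditioning on a random variable is conditioning
on the σ-algebra that it generates. -/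
def condEntropy {Ω : Type*} {α : Type*} {m₀ : MeasurableSpace Ω} [Fintype α]
    (P : Measure Ω) (A : Ω → α) (𝒢 : MeasurableSpace Ω) : ℝ :=
  (∫ ω, ∑ a, Real.negMulLog (condExp 𝒢 P ((A ⁻¹' {a}).indicator fun _ ↦ (1 : ℝ)) ω) ∂P) /
    Real.log 2

/-- The conditional mutual information `I(𝒲; A | 𝒞) = H(A | 𝒞) - H(A | 𝒲, 𝒞)`, in bits. -/
def condMutualInfo {Ω : Type*} {α : Type*} {m₀ : MeasurableSpace Ω} [Fintype α]
    (P : Measure Ω) (𝒲 : MeasurableSpace Ω) (A : Ω → α) (𝒞 : MeasurableSpace Ω) : ℝ :=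
  condEntropy P A 𝒞 - condEntropy P A (𝒲 ⊔ 𝒞)

inductive Player
  | alice
  | bob

/-- A two-party communication protocol with public and private randomness, on inputs from
`X × Y` and with outputs in `Z`.  The public random string and the private random strings of the
two players are drawn independently from arbitrary probability spaces. -/
structure Protocol (X : Type u) (Y : Type v) (Z : Type w) where
  /-- public random strings -/
  Pub : Type
  /-- private random strings of Alice -/
  PrivA : Type
  /-- private random strings of Bob -/
  PrivB : Type
  [mPub : MeasurableSpace Pub]
  [mPrivA : MeasurableSpace PrivA]
  [mPrivB : MeasurableSpace PrivB]
  pubLaw : Measure Pub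
  privALaw : Measure PrivA
  privBLaw : Measure PrivB
  [isProbPub : IsProbabilityMeasure pubLaw]
  [isProbPrivA : IsProbabilityMeasure privALaw]
  [isProbPrivB : IsProbabilityMeasure privBLaw]
  /-- who sends the next bit, given the public string and the bits transmitted so far;
  `none` means that the communication is over -/
  turn : Pub → List Bool → Option Player
  /-- the bit that Alice sends if it is her turn -/
  bitA : Pub → List Bool → X → PrivA → Bool
  /-- the bit that Bob sends if it is his turn -/
  bitB : Pub → List Bool → Y → PrivB → Bool
  /-- the output on which the players agree when the communication is over -/
  output : Pub → List Bool → Z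
  /-- a bound on the number of bits transmitted -/
  maxBits : ℕ
  turn_eq_none : ∀ r s, maxBits ≤ s.length → turn r s = none
  measurableSet_turn : ∀ s p, MeasurableSet {r | turn r s = p}
  measurableSet_bitA : ∀ s x, MeasurableSet {ra : Pub × PrivA | bitA ra.1 s x ra.2 = true}
  measurableSet_bitB : ∀ s y, MeasurableSet {rb : Pub × PrivB | bitB rb.1 s y rb.2 = true}
  measurableSet_output : ∀ s z, MeasurableSet {r | output r s = z}

attribute [instance] Protocol.mPub Protocol.mPrivA Protocol.mPrivB
  Protocol.isProbPub Protocol.isProbPrivA Protocol.isProbPrivB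

namespace Protocol

variable {X : Type u} {Y : Type v} {Z : Type w}

/-- All the randomness of the protocol: the public string and the two private strings. -/
abbrev Rand (π : Protocol X Y Z) : Type := π.Pub × π.PrivA × π.PrivB

/-- The law of the randomness of the protocol. -/
abbrev randLaw (π : Protocol X Y Z) : Measure π.Rand :=
  π.pubLaw.prod (π.privALaw.prod π.privBLaw)

/-- Run the protocol for at most `n` further bits, starting from the transmitted bits `s`. -/
def run (π : Protocol X Y Z) (xy : X × Y) (ρ : π.Rand) : ℕ → List Bool → List Bool
  | 0, s => s
  | n + 1, s =>
    match π.turn ρ.1 s with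
    | none => s
    | some Player.alice => run π xy ρ n (s ++ [π.bitA ρ.1 s xy.1 ρ.2.1])
    | some Player.bob => run π xy ρ n (s ++ [π.bitB ρ.1 s xy.2 ρ.2.2])

/-- The list of all bits transmitted in an execution. -/
def bits (π : Protocol X Y Z) (xy : X × Y) (ρ : π.Rand) : List Bool :=
  π.run xy ρ π.maxBits []

/-- The output `π(x, y)` of an execution. -/
def result (π : Protocol X Y Z) (xy : X × Y) (ρ : π.Rand) : Z :=
  π.output ρ.1 (π.bits xy ρ)

/-- The protocol performs the task `[f, ε]`: on every input, it errs with probability at most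
`ε`. -/
def Performs (π : Protocol X Y Z) (f : X × Y → Z) (ε : ℝ) : Prop :=
  ∀ xy, π.randLaw.real {ρ | π.result xy ρ ≠ f xy} ≤ ε

variable [MeasurableSpace X] [MeasurableSpace Y]

/-- The joint law of the inputs, drawn from `μ`, and of the independent randomness. -/
abbrev jointLaw (π : Protocol X Y Z) (μ : Measure (X × Y)) : Measure ((X × Y) × π.Rand) :=
  μ.prod π.randLaw

/-- The σ-algebra generated by the transcript, which consists of the public random string and of
the transmitted bits. -/
abbrev transcriptAlg (π : Protocol X Y Z) : MeasurableSpace ((X × Y) × π.Rand) :=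
  MeasurableSpace.comap (fun ω ↦ ω.2.1) π.mPub ⊔
    MeasurableSpace.comap (fun ω ↦ π.bits ω.1 ω.2) ⊤

/-- The internal information cost `I(Π; X | Y) + I(Π; Y | X)` of a protocol. -/
def infoCost [Fintype X] [Fintype Y] (π : Protocol X Y Z) (μ : Measure (X × Y)) : ℝ :=
  condMutualInfo (π.jointLaw μ) π.transcriptAlg (fun ω ↦ ω.1.1)
      (MeasurableSpace.comap (fun ω ↦ ω.1.2) ⊤) +
    condMutualInfo (π.jointLaw μ) π.transcriptAlg (fun ω ↦ ω.1.2)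
      (MeasurableSpace.comap (fun ω ↦ ω.1.1) ⊤)

end Protocol

/-- The information complexity `IC_μ(f, ε)`: the infimum of the internal information costs of the
protocols that perform `[f, ε]`. -/
def IC {X : Type u} {Y : Type v} {Z : Type w} [Fintype X] [Fintype Y]
    [MeasurableSpace X] [MeasurableSpace Y]
    (μ : Measure (X × Y)) (f : X × Y → Z) (ε : ℝ) : ℝ :=
  ⨅ π : {π : Protocol X Y Z // π.Performs f ε}, π.1.infoCost μ

end CommInfo

end

/-! Let p(xy, t) be the likelihood of the transcript t on the input xy. Up to the factor 1 / log 2,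
the cost of a protocol is the prior uncertainty about the inputs minus the integral over t of the
entropies of the weights μ(xy) p(xy, t) along all rows and columns (`infoCost_eq`). This entropy of
unnormalised weights is monotone and homogeneous of degree one.

Start from a zero-error protocol and two support points a, b on a common line. With probability ε,
the player who can tell them apart secretly plays the input of a (`perturb`). The error is at most
ε. The new likelihoods are at least (1 - ε) p, so the residual entropy loses only O(ε). On a
transcript that nearly excludes b, meaning p(b, t) ≤ ε p(a, t), the likelihood of b is lifted to
order ε p(a, t), which creates entropy of about ε μ(b) log(1/ε) p(a, t). In total the gain is of
order ε log(1/ε) times the probability `exclusion a b ε`. It beats the loss and is comparable to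
h(ε). So it suffices that zero-error protocols arbitrarily close to optimal have exclusion at least
some q independent of ε; then τ = μ(b) q / 2 works.

Likelihoods are a factor of Alice times a factor of Bob, so a transcript possible on (x, y) and (x',
y') is possible on (x, y'). This gives q = 1 if f(a) ≠ f(b), and q = 1/2 for one of the two
neighbours in the AND case. In general, suppose that exclusion is rare for every pair of support
points on a line. Rare exclusion is transitive (`exclusion_trans_le`), so it spreads over the
connected components of the support and makes f constant on the rectangle spanned by each component.
The players can then announce the components of their inputs and reveal everything only if these
disagree. This computes f and costs nothing on the support, against IC > 0
(`exists_not_rarelyExcludes`). -/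

namespace CommInfo

/-! ### Entropy of unnormalised weight vectors -/

/-- The entropy (in nats) of the finite nonnegative weight vector `m`, scaled by its total
mass. -/
noncomputable def massEntropy {ι : Type*} [Fintype ι] (m : ι → ℝ) : ℝ :=
  ∑ i, m i * Real.log ((∑ j, m j) / m i)

section massEntropy

variable {ι : Type*} [Fintype ι]

lemma log_total_div_nonneg {m : ι → ℝ} (hm : ∀ i, 0 ≤ m i) (i : ι) :
    0 ≤ Real.log ((∑ j, m j) / m i) := by
  have hle : m i ≤ ∑ j, m j := Finset.single_le_sum (fun j _ ↦ hm j) (Finset.mem_univ i)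
  rcases (hm i).eq_or_lt with h0 | h0
  -- For a zero weight the quotient is division by zero, and the logarithm takes its default value
  -- 0.
  · simp [← h0]
  · exact Real.log_nonneg ((one_le_div h0).2 hle)

lemma massEntropy_nonneg {m : ι → ℝ} (hm : ∀ i, 0 ≤ m i) : 0 ≤ massEntropy m :=
  Finset.sum_nonneg fun i _ ↦ mul_nonneg (hm i) (log_total_div_nonneg hm i)

/-- Homogeneity is the reason for not normalising: transcript densities can stay inside the weights,
and mixing costs just a factor `1 - ε`. -/
lemma massEntropy_smul (c : ℝ) (m : ι → ℝ) :
    massEntropy (fun i ↦ c * m i) = c * massEntropy m := by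
  rcases eq_or_ne c 0 with rfl | hc
  · simp [massEntropy]
  · simp only [massEntropy, ← Finset.mul_sum, mul_div_mul_left _ _ hc, mul_assoc]

/-- From `log u ≤ u`. The constant is crude, but linearity in the total mass is all that
integrability and the O(ε) loss require. -/
lemma massEntropy_le_card_mul {m : ι → ℝ} (hm : ∀ i, 0 ≤ m i) :
    massEntropy m ≤ Fintype.card ι * ∑ i, m i := by
  have hM : 0 ≤ ∑ i, m i := Finset.sum_nonneg fun i _ ↦ hm i
  calc massEntropy m ≤ ∑ _i : ι, ∑ j, m j := by
        refine Finset.sum_le_sum fun i _ ↦ ?_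
        rcases (hm i).eq_or_lt with h0 | h0
        · rw [← h0, zero_mul]; exact hM
        · calc m i * Real.log ((∑ j, m j) / m i) ≤ m i * ((∑ j, m j) / m i) :=
                mul_le_mul_of_nonneg_left (Real.log_le_self (div_nonneg hM h0.le)) h0.le
            _ = ∑ j, m j := by field_simp
    _ = Fintype.card ι * ∑ i, m i := by simp

/-- Gibbs' inequality for weight vectors. -/
lemma massEntropy_le_cross {m n : ι → ℝ} (hm : ∀ i, 0 ≤ m i) (hn : ∀ i, 0 ≤ n i)
    (hmn : ∀ i, n i = 0 → m i = 0) :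
    massEntropy m ≤ ∑ i, m i * Real.log ((∑ j, n j) / n i) := by
  set M := ∑ j, m j with hM
  set N := ∑ j, n j with hN
  have hM0 : 0 ≤ M := Finset.sum_nonneg fun i _ ↦ hm i
  have hN0 : 0 ≤ N := Finset.sum_nonneg fun i _ ↦ hn i
  rcases hN0.eq_or_lt with hN0' | hNpos
  · have hn0 : ∀ i, n i = 0 := fun i ↦
      (Finset.sum_eq_zero_iff_of_nonneg fun i _ ↦ hn i).1 hN0'.symm i (Finset.mem_univ i)
    simp [massEntropy, fun i ↦ hmn i (hn0 i)]
  have key : ∀ i, m i * Real.log (M / m i) - m i * Real.log (N / n i) ≤ M * n i / N - m i := by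
    intro i
    rcases (hm i).eq_or_lt with h0 | h0
    · rw [← h0]
      simpa using div_nonneg (mul_nonneg hM0 (hn i)) hN0
    have hni : 0 < n i := (hn i).lt_of_ne fun h ↦ h0.ne' (hmn i h.symm)
    have hMpos : 0 < M := h0.trans_le (Finset.single_le_sum (fun j _ ↦ hm j) (Finset.mem_univ i))
    have hlog : Real.log (M / m i) - Real.log (N / n i) = Real.log (M * n i / (N * m i)) := by
      rw [← Real.log_div (by positivity) (by positivity)]
      congr 1
      field_simp
    rw [← mul_sub, hlog]
    calc m i * Real.log (M * n i / (N * m i)) ≤ m i * (M * n i / (N * m i) - 1) :=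
          mul_le_mul_of_nonneg_left (Real.log_le_sub_one_of_pos (by positivity)) h0.le
      _ = M * n i / N - m i := by field_simp
  have hsum := Finset.sum_le_sum fun i (_ : i ∈ Finset.univ) ↦ key i
  rw [Finset.sum_sub_distrib, Finset.sum_sub_distrib, ← Finset.sum_div, ← Finset.mul_sum, ← hM,
    ← hN, mul_div_cancel_right₀ _ hNpos.ne', sub_self] at hsum
  simpa [massEntropy] using hsum

/-- Raising the weight of `i` raises the entropy in proportion to its surprisal. -/
lemma massEntropy_add_le {m n : ι → ℝ} (hm : ∀ i, 0 ≤ m i) (hmn : ∀ i, m i ≤ n i) (i : ι) :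
    massEntropy m + (n i - m i) * Real.log ((∑ j, n j) / n i) ≤ massEntropy n := by
  have hn : ∀ i, 0 ≤ n i := fun i ↦ (hm i).trans (hmn i)
  have h1 := massEntropy_le_cross hm hn fun i h ↦ le_antisymm ((hmn i).trans h.le) (hm i)
  have h2 : (n i - m i) * Real.log ((∑ j, n j) / n i) ≤
      ∑ k, (n k - m k) * Real.log ((∑ j, n j) / n k) :=
    Finset.single_le_sum (f := fun k ↦ (n k - m k) * Real.log ((∑ j, n j) / n k))
      (fun k _ ↦ mul_nonneg (sub_nonneg.2 (hmn k)) (log_total_div_nonneg hn k))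
      (Finset.mem_univ i)
  have h3 : ∑ k, (n k - m k) * Real.log ((∑ j, n j) / n k) =
      massEntropy n - ∑ k, m k * Real.log ((∑ j, n j) / n k) := by
    simp [massEntropy, sub_mul, Finset.sum_sub_distrib]
  linarith

lemma massEntropy_mono {m n : ι → ℝ} (hm : ∀ i, 0 ≤ m i) (hmn : ∀ i, m i ≤ n i) :
    massEntropy m ≤ massEntropy n := by
  rcases isEmpty_or_nonempty ι with _ | ⟨⟨i⟩⟩
  · simp [massEntropy]
  · refine le_trans ?_ (massEntropy_add_le hm hmn i)
    exact le_add_of_nonneg_right (mul_nonneg (sub_nonneg.2 (hmn i))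
      (log_total_div_nonneg (fun i ↦ (hm i).trans (hmn i)) i))

lemma measurable_massEntropy : Measurable (massEntropy : (ι → ℝ) → ℝ) := by
  unfold massEntropy
  fun_prop

lemma total_mul_sum_negMulLog {m : ι → ℝ} (hm : ∀ i, 0 ≤ m i) :
    (∑ j, m j) * ∑ i, Real.negMulLog (m i / ∑ j, m j) = massEntropy m := by
  rw [massEntropy, Finset.mul_sum]
  refine Finset.sum_congr rfl fun i _ ↦ ?_
  by_cases hM : ∑ j, m j = 0
  · have : m i = 0 :=
      (Finset.sum_eq_zero_iff_of_nonneg fun i _ ↦ hm i).1 hM i (Finset.mem_univ i)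
    simp [this]
  · rw [Real.negMulLog, ← inv_div (m i) (∑ j, m j), Real.log_inv]
    field_simp

end massEntropy

/-! ### Conditional entropies in terms of transcript densities -/

section Density

variable {I R S : Type*} [MeasurableSpace R] [MeasurableSpace S]
  {Q : Measure R} [IsProbabilityMeasure Q] {κ : Measure S} {T : I → R → S} {p : I → S → ℝ}

lemma integrable_density (hT : ∀ i, Measurable (T i)) (hp : ∀ i, Measurable (p i))
    (hp0 : ∀ i t, 0 ≤ p i t)
    (hlaw : ∀ i, Q.map (T i) = κ.withDensity fun t ↦ ENNReal.ofReal (p i t)) (i : I) :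
    Integrable (p i) κ := by
  refine ⟨(hp i).aestronglyMeasurable, ?_⟩
  rw [hasFiniteIntegral_iff_ofReal (.of_forall (hp0 i)), ← setLIntegral_univ,
    ← withDensity_apply _ MeasurableSet.univ, ← hlaw i,
    Measure.map_apply (hT i) MeasurableSet.univ]
  simp

lemma integral_density (hT : ∀ i, Measurable (T i)) (hp : ∀ i, Measurable (p i))
    (hp0 : ∀ i t, 0 ≤ p i t)
    (hlaw : ∀ i, Q.map (T i) = κ.withDensity fun t ↦ ENNReal.ofReal (p i t)) (i : I) :
    ∫ t, p i t ∂κ = 1 := by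
  rw [integral_eq_lintegral_of_nonneg_ae (.of_forall (hp0 i)) (hp i).aestronglyMeasurable,
    ← setLIntegral_univ, ← withDensity_apply _ MeasurableSet.univ, ← hlaw i,
    Measure.map_apply (hT i) MeasurableSet.univ]
  simp

variable [Fintype I] [MeasurableSpace I] [DiscreteMeasurableSpace I]
  {μ : Measure I} [IsProbabilityMeasure μ]

lemma integral_input_transcript (hT : ∀ i, Measurable (T i)) (hp : ∀ i, Measurable (p i))
    (hp0 : ∀ i t, 0 ≤ p i t)
    (hlaw : ∀ i, Q.map (T i) = κ.withDensity fun t ↦ ENNReal.ofReal (p i t))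
    {F : I → S → ℝ} (hF : ∀ i, Measurable (F i)) {C : ℝ} (hC : ∀ i t, ‖F i t‖ ≤ C) :
    ∫ ω, F ω.1 (T ω.1 ω.2) ∂(μ.prod Q) = ∑ i, μ.real {i} * ∫ t, F i t * p i t ∂κ := by
  have hint : Integrable (fun ω : I × R ↦ F ω.1 (T ω.1 ω.2)) (μ.prod Q) :=
    Integrable.of_bound (measurable_from_prod_countable_right fun i ↦ (hF i).comp (hT i)).aestronglyMeasurable C
      (.of_forall fun ω ↦ hC _ _)
  rw [integral_prod _ hint, integral_fintype hint.integral_prod_left]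
  refine Finset.sum_congr rfl fun i _ ↦ ?_
  rw [smul_eq_mul]
  congr 1
  rw [← integral_map (hT i).aemeasurable (hF i).aestronglyMeasurable, hlaw i,
    integral_withDensity_eq_integral_toReal_smul (hp i).ennreal_ofReal
      (.of_forall fun _ ↦ ENNReal.ofReal_lt_top)]
  refine integral_congr_ae (.of_forall fun t ↦ ?_)
  simp [ENNReal.toReal_ofReal (hp0 i t), mul_comm]

end Density

section JointMass

variable {I S α γ : Type*} [MeasurableSpace I] {μ : Measure I} {p : I → S → ℝ}

/-- The joint weight of the input with coordinates `a` and `c` and of the transcript `t`. -/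
noncomputable def jointMass (μ : Measure I) (p : I → S → ℝ) (e : I ≃ α × γ) (t : S) (c : γ)
    (a : α) : ℝ :=
  μ.real {e.symm (a, c)} * p (e.symm (a, c)) t

lemma jointMass_nonneg (hp0 : ∀ i t, 0 ≤ p i t) (e : I ≃ α × γ) (t : S) (c : γ) (a : α) :
    0 ≤ jointMass μ p e t c a :=
  mul_nonneg measureReal_nonneg (hp0 _ _)

lemma measurable_jointMass [MeasurableSpace S] (hp : ∀ i, Measurable (p i)) (e : I ≃ α × γ) (c : γ) (a : α) :
    Measurable fun t ↦ jointMass μ p e t c a :=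
  (hp _).const_mul _

lemma jointMass_div_total_mem [Fintype α] (hp0 : ∀ i t, 0 ≤ p i t) (e : I ≃ α × γ) (t : S) (c : γ) (a : α) :
    jointMass μ p e t c a / ∑ a', jointMass μ p e t c a' ∈ Set.Icc (0 : ℝ) 1 := by
  have h := fun a ↦ jointMass_nonneg (μ := μ) hp0 e t c a
  exact ⟨div_nonneg (h a) (Finset.sum_nonneg fun a _ ↦ h a),
    div_le_one_of_le₀ (Finset.single_le_sum (fun a _ ↦ h a) (Finset.mem_univ a))
      (Finset.sum_nonneg fun a _ ↦ h a)⟩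

lemma sum_eq_sum_fibers {I α γ : Type*} [Fintype I] [Fintype α]
    [Fintype γ] (e : I ≃ α × γ) (F : I → ℝ) :
    ∑ i, F i = ∑ c, ∑ a, F (e.symm (a, c)) := by
  rw [← e.symm.sum_comp, Fintype.sum_prod_type_right]

end JointMass

section CondEntropy

variable {I R S α γ : Type*} [Fintype I] [MeasurableSpace I] [DiscreteMeasurableSpace I]
  [MeasurableSpace R] [MeasurableSpace S] [Fintype α] [Fintype γ]
  {μ : Measure I} [IsProbabilityMeasure μ]
  {Q : Measure R} [IsProbabilityMeasure Q] {κ : Measure S} {T : I → R → S} {p : I → S → ℝ}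

/-- Bayes' rule. Tested on a set of pairs (transcript, `c`), both sides become sums of integrals
against `κ`, and they agree for each `c` because posterior times total mass is joint mass. The
equivalence `e` selects which coordinate is predicted, so one proof serves both halves of the
information cost. -/
lemma condExp_input_eq (hT : ∀ i, Measurable (T i)) (hp : ∀ i, Measurable (p i))
    (hp0 : ∀ i t, 0 ≤ p i t)
    (hlaw : ∀ i, Q.map (T i) = κ.withDensity fun t ↦ ENNReal.ofReal (p i t))
    (e : I ≃ α × γ) (a : α) :
    condExp (MeasurableSpace.comap (fun ω : I × R ↦ T ω.1 ω.2) inferInstance ⊔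
        MeasurableSpace.comap (fun ω : I × R ↦ (e ω.1).2) ⊤) (μ.prod Q)
        (((fun ω : I × R ↦ (e ω.1).1) ⁻¹' {a}).indicator fun _ ↦ (1 : ℝ)) =ᵐ[μ.prod Q]
      fun ω ↦ jointMass μ p e (T ω.1 ω.2) (e ω.1).2 a /
        ∑ a', jointMass μ p e (T ω.1 ω.2) (e ω.1).2 a' := by
  let _ : MeasurableSpace γ := ⊤
  let _ : MeasurableSpace α := ⊤
  have hU : Measurable fun ω : I × R ↦ (T ω.1 ω.2, (e ω.1).2) :=
    (measurable_from_prod_countable_right hT).prodMk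
      ((Measurable.of_discrete (f := fun i ↦ (e i).2)).comp measurable_fst)
  have hsup : MeasurableSpace.comap (fun ω : I × R ↦ T ω.1 ω.2) inferInstance ⊔
      MeasurableSpace.comap (fun ω : I × R ↦ (e ω.1).2) ⊤ =
      MeasurableSpace.comap (fun ω : I × R ↦ (T ω.1 ω.2, (e ω.1).2)) inferInstance := by
    rw [show (inferInstance : MeasurableSpace (S × γ)) = MeasurableSpace.prod _ _ from rfl,
      MeasurableSpace.prod, MeasurableSpace.comap_sup, MeasurableSpace.comap_comp,
      MeasurableSpace.comap_comp]
    rfl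
  rw [hsup]
  have hA : MeasurableSet ((fun ω : I × R ↦ (e ω.1).1) ⁻¹' {a}) :=
    (Measurable.of_discrete (f := fun i ↦ (e i).1)).comp measurable_fst (measurableSet_singleton a)
  set g : S × γ → ℝ := fun x ↦ jointMass μ p e x.1 x.2 a / ∑ a', jointMass μ p e x.1 x.2 a'
    with hg
  have hgm : Measurable g := by
    refine measurable_from_prod_countable_left fun c ↦ ?_
    exact (measurable_jointMass hp e c a).div
      (Finset.measurable_sum _ fun a' _ ↦ measurable_jointMass hp e c a')
  have hgb : ∀ x, ‖g x‖ ≤ 1 := fun x ↦ by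
    have := jointMass_div_total_mem (μ := μ) hp0 e x.1 x.2 a
    rw [Real.norm_of_nonneg this.1]
    exact this.2
  have hm := hU.comap_le
  have hgU : Integrable (fun ω : I × R ↦ g (T ω.1 ω.2, (e ω.1).2)) (μ.prod Q) :=
    Integrable.of_bound (hgm.comp hU).aestronglyMeasurable 1 (.of_forall fun ω ↦ hgb _)
  symm
  refine ae_eq_condExp_of_forall_setIntegral_eq hm
    ((integrable_const (1 : ℝ)).indicator hA) (fun s _ _ ↦ hgU.integrableOn) ?_
    ((hgm.comp (comap_measurable _)).stronglyMeasurable.aestronglyMeasurable)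
  rintro s ⟨B, hB, rfl⟩ -
  rw [← integral_indicator (hm _ ⟨B, hB, rfl⟩), ← integral_indicator (hm _ ⟨B, hB, rfl⟩)]
  have hBc : ∀ c : γ, MeasurableSet {t : S | (t, c) ∈ B} := fun c ↦ measurable_prodMk_right hB
  classical
  have h1 := integral_input_transcript (μ := μ) hT hp hp0 hlaw
    (F := fun i t ↦ {t : S | (t, (e i).2) ∈ B}.indicator (fun t ↦ g (t, (e i).2)) t) (C := 1)
    (fun i ↦ (hgm.comp measurable_prodMk_right).indicator (hBc _))
    (fun i t ↦ (norm_indicator_le_norm_self _ _).trans (hgb _))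
  have h2 := integral_input_transcript (μ := μ) hT hp hp0 hlaw
    (F := fun i t ↦ {t : S | (t, (e i).2) ∈ B}.indicator
      (fun _ ↦ if (e i).1 = a then (1 : ℝ) else 0) t) (C := 1)
    (fun i ↦ measurable_const.indicator (hBc _))
    (fun i t ↦ (norm_indicator_le_norm_self _ _).trans (by split_ifs <;> simp))
  have e1 : ∀ ω : I × R, ((fun ω : I × R ↦ (T ω.1 ω.2, (e ω.1).2)) ⁻¹' B).indicator
      (fun ω ↦ g (T ω.1 ω.2, (e ω.1).2)) ω =
      {t : S | (t, (e ω.1).2) ∈ B}.indicator (fun t ↦ g (t, (e ω.1).2)) (T ω.1 ω.2) := by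
    intro ω; simp only [Set.indicator_apply, Set.mem_preimage, Set.mem_ofPred_eq]
  have e2 : ∀ ω : I × R, ((fun ω : I × R ↦ (T ω.1 ω.2, (e ω.1).2)) ⁻¹' B).indicator
      (((fun ω : I × R ↦ (e ω.1).1) ⁻¹' {a}).indicator fun _ ↦ (1 : ℝ)) ω =
      {t : S | (t, (e ω.1).2) ∈ B}.indicator
      (fun _ ↦ if (e ω.1).1 = a then (1 : ℝ) else 0) (T ω.1 ω.2) := by
    intro ω
    simp only [Set.indicator_apply, Set.mem_preimage, Set.mem_ofPred_eq, Set.mem_singleton_iff]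
  have hpi := integrable_density hT hp hp0 hlaw
  refine (integral_congr_ae (.of_forall e1)).trans (h1.trans (Eq.trans ?_
    ((integral_congr_ae (.of_forall e2)).trans h2).symm))
  rw [sum_eq_sum_fibers e, sum_eq_sum_fibers e]
  refine Finset.sum_congr rfl fun c _ ↦ ?_
  simp only [Equiv.apply_symm_apply]
  simp_rw [← integral_const_mul]
  have hb1 : ∀ t, ‖{t : S | (t, c) ∈ B}.indicator (fun t ↦ g (t, c)) t‖ ≤ 1 := fun t ↦
    (norm_indicator_le_norm_self _ _).trans (hgb _)
  rw [← integral_finsetSum _ fun a' _ ↦ ?_, ← integral_finsetSum _ fun a' _ ↦ ?_]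
  · refine integral_congr_ae (.of_forall fun t ↦ ?_)
    by_cases ht : (t, c) ∈ B
    · simp only [Set.indicator_apply, Set.mem_ofPred_eq, ht, if_true, ite_mul, one_mul, zero_mul,
        mul_ite, mul_zero, Finset.sum_ite_eq', Finset.mem_univ]
      have h := fun a ↦ jointMass_nonneg (μ := μ) hp0 e t c a
      calc ∑ a', μ.real {e.symm (a', c)} * (g (t, c) * p (e.symm (a', c)) t)
          = g (t, c) * ∑ a', jointMass μ p e t c a' := by
            rw [Finset.mul_sum]
            exact Finset.sum_congr rfl fun a' _ ↦ by rw [jointMass]; ring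
        _ = jointMass μ p e t c a := by
            simp only [hg]
            -- If the total mass is 0, the posterior is the default value 0/0 = 0, but then the
            -- joint mass vanishes too.
            by_cases hM : ∑ a', jointMass μ p e t c a' = 0
            · rw [hM, mul_zero, (Finset.sum_eq_zero_iff_of_nonneg fun a _ ↦ h a).1 hM a
                (Finset.mem_univ a)]
            · rw [div_mul_cancel₀ _ hM]
        _ = _ := rfl
    · simp [ht]
  · refine ((hpi _).bdd_mul (c := 1) ?_ (.of_forall fun t ↦ ?_)).const_mul _
    · exact (measurable_const.indicator (hBc _)).aestronglyMeasurable
    · exact (norm_indicator_le_norm_self _ _).trans (by split_ifs <;> simp)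
  · refine ((hpi _).bdd_mul (c := 1) ?_ (.of_forall hb1)).const_mul _
    exact ((hgm.comp measurable_prodMk_right).indicator (hBc _)).aestronglyMeasurable

omit [Fintype I] [DiscreteMeasurableSpace I] [Fintype γ] [IsProbabilityMeasure μ] in
lemma integrable_massEntropy_jointMass (hT : ∀ i, Measurable (T i)) (hp : ∀ i, Measurable (p i))
    (hp0 : ∀ i t, 0 ≤ p i t)
    (hlaw : ∀ i, Q.map (T i) = κ.withDensity fun t ↦ ENNReal.ofReal (p i t))
    (e : I ≃ α × γ) (c : γ) :
    Integrable (fun t ↦ massEntropy (jointMass μ p e t c)) κ := by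
  have hpi := integrable_density hT hp hp0 hlaw
  have h := fun t a ↦ jointMass_nonneg (μ := μ) hp0 e t c a
  refine Integrable.mono' (g := fun t ↦ Fintype.card α * ∑ a, jointMass μ p e t c a) ?_
    (measurable_massEntropy.comp (measurable_pi_lambda _ fun a ↦
      measurable_jointMass hp e c a)).aestronglyMeasurable (.of_forall fun t ↦ ?_)
  · exact (integrable_finsetSum _ fun a _ ↦ (hpi _).const_mul _).const_mul _
  · rw [Real.norm_of_nonneg (massEntropy_nonneg (h t))]
    exact massEntropy_le_card_mul (h t)

/-- The conditional entropy of one coordinate of the input, given a transcript and the other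
coordinate, in terms of the densities of the transcript. -/
lemma condEntropy_eq_integral (hT : ∀ i, Measurable (T i)) (hp : ∀ i, Measurable (p i))
    (hp0 : ∀ i t, 0 ≤ p i t)
    (hlaw : ∀ i, Q.map (T i) = κ.withDensity fun t ↦ ENNReal.ofReal (p i t))
    (e : I ≃ α × γ) :
    condEntropy (μ.prod Q) (fun ω : I × R ↦ (e ω.1).1)
      (MeasurableSpace.comap (fun ω : I × R ↦ T ω.1 ω.2) inferInstance ⊔
        MeasurableSpace.comap (fun ω : I × R ↦ (e ω.1).2) ⊤) =
      (∫ t, ∑ c, massEntropy (jointMass μ p e t c) ∂κ) / Real.log 2 := by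
  rw [condEntropy]
  congr 1
  have hae := ae_all_iff.2 (condExp_input_eq (μ := μ) hT hp hp0 hlaw e)
  set G : I → S → ℝ := fun i t ↦ ∑ a, Real.negMulLog (jointMass μ p e t (e i).2 a /
        ∑ a', jointMass μ p e t (e i).2 a') with hG
  have hGm : ∀ i, Measurable (G i) := fun i ↦
    Finset.measurable_sum _ fun a _ ↦ Real.continuous_negMulLog.measurable.comp
      ((measurable_jointMass hp e _ a).div
        (Finset.measurable_sum _ fun a' _ ↦ measurable_jointMass hp e _ a'))
  have hGb : ∀ i t, ‖G i t‖ ≤ Fintype.card α := by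
    intro i t
    refine (norm_sum_le _ _).trans ?_
    calc _ ≤ ∑ _a : α, (1 : ℝ) := Finset.sum_le_sum fun a _ ↦ ?_
      _ = Fintype.card α := by simp
    obtain ⟨h0, h1⟩ := jointMass_div_total_mem (μ := μ) hp0 e t (e i).2 a
    rw [Real.norm_of_nonneg (Real.negMulLog_nonneg h0 h1)]
    exact (Real.negMulLog_le_one_sub_self h0).trans (by linarith)
  calc _ = ∫ ω, G ω.1 (T ω.1 ω.2) ∂(μ.prod Q) := by
        refine integral_congr_ae ?_
        filter_upwards [hae] with ω hω
        simp only [hω, hG]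
    _ = _ := integral_input_transcript hT hp hp0 hlaw hGm hGb
    _ = ∑ c, ∫ t, massEntropy (jointMass μ p e t c) ∂κ := by
        rw [sum_eq_sum_fibers e]
        refine Finset.sum_congr rfl fun c _ ↦ ?_
        simp_rw [← integral_const_mul]
        have hpi := integrable_density hT hp hp0 hlaw
        rw [← integral_finsetSum _ fun a _ ↦ ((hpi _).bdd_mul (hGm _).aestronglyMeasurable
          (.of_forall (hGb _))).const_mul _]
        refine integral_congr_ae (.of_forall fun t ↦ ?_)
        simp only [hG, Equiv.apply_symm_apply]
        rw [← total_mul_sum_negMulLog fun a ↦ jointMass_nonneg hp0 e t c a, Finset.sum_mul]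
        refine Finset.sum_congr rfl fun a _ ↦ ?_
        rw [jointMass]
        ring
    _ = _ := (integral_finsetSum _ fun c _ ↦
        integrable_massEntropy_jointMass hT hp hp0 hlaw e c).symm

/-- Without a transcript, the conditional entropy depends only on the law of the input. -/
lemma condEntropy_input (e : I ≃ α × γ) :
    condEntropy (μ.prod Q) (fun ω : I × R ↦ (e ω.1).1)
      (MeasurableSpace.comap (fun ω : I × R ↦ (e ω.1).2) ⊤) =
      (∑ c, massEntropy fun a ↦ μ.real {e.symm (a, c)}) / Real.log 2 := by
  -- A one-point transcript space with density 1 adds no information.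
  have h := condEntropy_eq_integral (μ := μ) (Q := Q) (κ := Measure.dirac ())
    (T := fun _ _ ↦ ()) (p := fun _ _ ↦ 1) (fun _ ↦ measurable_const) (fun _ ↦ measurable_const)
    (fun _ _ ↦ zero_le_one) (fun _ ↦ by simp [Measure.map_const]) e
  rw [MeasurableSpace.comap_const, bot_sup_eq] at h
  have hone : ∀ c, jointMass μ (fun _ (_ : Unit) ↦ (1 : ℝ)) e () c =
      fun a ↦ μ.real {e.symm (a, c)} := fun c ↦ funext fun a ↦ mul_one _
  rw [h, integral_dirac]
  simp only [hone]

end CondEntropy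

/-! ### Executions of a protocol -/

instance : MeasurableSpace (List Bool) := ⊤

instance : DiscreteMeasurableSpace (List Bool) := ⟨fun _ ↦ trivial⟩

namespace Protocol

variable {X : Type u} {Y : Type v} {Z : Type w} (π : Protocol X Y Z)

section Run

/-- The bit sent after the bits `s`, if the communication is not over. -/
def nextBit (xy : X × Y) (ρ : π.Rand) (s : List Bool) : Option Bool :=
  match π.turn ρ.1 s with
  | none => none
  | some Player.alice => some (π.bitA ρ.1 s xy.1 ρ.2.1)
  | some Player.bob => some (π.bitB ρ.1 s xy.2 ρ.2.2)

lemma run_succ (xy : X × Y) (ρ : π.Rand) (n : ℕ) (s : List Bool) :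
    π.run xy ρ (n + 1) s = match π.nextBit xy ρ s with
      | none => s
      | some b => π.run xy ρ n (s ++ [b]) := by
  rw [run, nextBit]
  rcases π.turn ρ.1 s with _ | _ | _ <;> rfl

lemma nextBit_eq_none {xy : X × Y} {ρ : π.Rand} {s : List Bool} (h : π.maxBits ≤ s.length) :
    π.nextBit xy ρ s = none := by
  rw [nextBit, π.turn_eq_none _ _ h]

variable {π}

lemma run_eq_of_nextBit {xy : X × Y} {ρ : π.Rand} {s : List Bool}
    (hs : ∀ i ≤ s.length, π.nextBit xy ρ (s.take i) = s[i]?) (n i : ℕ)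
    (hi : i ≤ s.length) (hn : s.length ≤ i + n) : π.run xy ρ n (s.take i) = s := by
  induction n generalizing i with
  | zero => rw [run, List.take_of_length_le (by omega)]
  | succ n ih =>
    rw [run_succ, hs i hi]
    rcases hi.eq_or_lt with rfl | hlt
    · simp
    · rw [List.getElem?_eq_getElem hlt]
      simp only [List.take_concat_get']
      exact ih (i + 1) hlt (by omega)

lemma nextBit_run {xy : X × Y} {ρ : π.Rand} (n : ℕ) (s : List Bool)
    (hs : ∀ i < s.length, π.nextBit xy ρ (s.take i) = s[i]?) :
    ∀ i < (π.run xy ρ n s).length,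
      π.nextBit xy ρ ((π.run xy ρ n s).take i) = (π.run xy ρ n s)[i]? := by
  induction n generalizing s with
  | zero => exact hs
  | succ n ih =>
    rw [run_succ]
    rcases hb : π.nextBit xy ρ s with _ | b
    · exact hs
    · refine ih _ fun i hi ↦ ?_
      rw [List.length_append, List.length_singleton, Nat.lt_succ_iff] at hi
      rcases hi.eq_or_lt with rfl | hlt
      · simpa using hb
      · rw [List.take_append_of_le_length hlt.le, List.getElem?_append_left hlt]
        exact hs i hlt

lemma nextBit_run_eq_none {xy : X × Y} {ρ : π.Rand} (n : ℕ) (s : List Bool)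
    (hn : π.maxBits ≤ s.length + n) : π.nextBit xy ρ (π.run xy ρ n s) = none := by
  induction n generalizing s with
  | zero => exact π.nextBit_eq_none hn
  | succ n ih =>
    rw [run_succ]
    rcases hb : π.nextBit xy ρ s with _ | b
    · exact hb
    · exact ih _ (by simp; omega)

/-- Replaces the recursion by one local condition per prefix. The index `i = s.length` is included:
there `s[i]?` is `none`, which says that the communication stops. -/
lemma bits_eq_iff_nextBit {xy : X × Y} {ρ : π.Rand} {s : List Bool} :
    π.bits xy ρ = s ↔ ∀ i ≤ s.length, π.nextBit xy ρ (s.take i) = s[i]? := by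
  constructor
  · rintro rfl i hi
    rcases hi.eq_or_lt with rfl | hlt
    · rw [List.take_length, List.getElem?_eq_none le_rfl]
      exact nextBit_run_eq_none _ _ (by simp)
    · exact nextBit_run _ _ (by simp) i hlt
  · intro hs
    have hlen : s.length ≤ π.maxBits := by
      by_contra! hlt
      have h := hs π.maxBits hlt.le
      rw [nextBit_eq_none, List.getElem?_eq_getElem hlt] at h
      · simp at h
      · simp [hlt.le]
    have h := run_eq_of_nextBit hs π.maxBits 0 (Nat.zero_le _) (by omega)
    rwa [List.take_zero] at h

variable (π)

/-- Given the public string `r`, the communication is over exactly after the bits `s`. -/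
def Ended (r : π.Pub) (s : List Bool) : Prop :=
  ∀ i ≤ s.length, (π.turn r (s.take i) = none ↔ s[i]? = none)

/-- Alice's bits in `s` are those that she sends with the input `x` and the private
string `a`. -/
def ConsistentA (r : π.Pub) (s : List Bool) (x : X) (a : π.PrivA) : Prop :=
  ∀ i ≤ s.length, π.turn r (s.take i) = some Player.alice →
    some (π.bitA r (s.take i) x a) = s[i]?

/-- Bob's bits in `s` are those that he sends with the input `y` and the private string `b`. -/
def ConsistentB (r : π.Pub) (s : List Bool) (y : Y) (b : π.PrivB) : Prop :=
  ∀ i ≤ s.length, π.turn r (s.take i) = some Player.bob →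
    some (π.bitB r (s.take i) y b) = s[i]?

/-- Each local condition belongs to whoever has the turn, and the turn depends only on the public
string and the prefix. Hence the event splits into one on Alice's data and one on Bob's, the source
of the rectangle property. -/
lemma bits_eq_iff {xy : X × Y} {ρ : π.Rand} {s : List Bool} :
    π.bits xy ρ = s ↔ π.Ended ρ.1 s ∧ π.ConsistentA ρ.1 s xy.1 ρ.2.1 ∧
      π.ConsistentB ρ.1 s xy.2 ρ.2.2 := by
  rw [bits_eq_iff_nextBit, Ended, ConsistentA, ConsistentB, ← forall_and, ← forall_and]
  refine forall_congr' fun i ↦ ?_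
  rw [← forall_and, ← forall_and]
  refine forall_congr' fun _ ↦ ?_
  rw [nextBit]
  rcases π.turn ρ.1 (s.take i) with _ | _ | _
  · simp [eq_comm]
  · simp only [reduceCtorEq, false_iff, forall_const, Option.some.injEq, IsEmpty.forall_iff,
      and_true]
    constructor
    · intro h; rw [← h]; simp
    · exact fun h ↦ h.2
  · simp only [reduceCtorEq, false_iff, forall_const, Option.some.injEq, IsEmpty.forall_iff,
      true_and]
    constructor
    · intro h; rw [← h]; simp
    · exact fun h ↦ h.2

lemma measurableSet_ended (s : List Bool) : MeasurableSet {r | π.Ended r s} := by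
  simp only [Ended, Set.ofPred_forall]
  refine MeasurableSet.iInter fun i ↦ MeasurableSet.iInter fun _ ↦ ?_
  by_cases h : s[i]? = none
  · simpa only [h, iff_true] using π.measurableSet_turn _ _
  · simp only [h, iff_false]
    exact (π.measurableSet_turn _ _).compl

lemma measurableSet_consistentA (s : List Bool) (x : X) :
    MeasurableSet {ra : π.Pub × π.PrivA | π.ConsistentA ra.1 s x ra.2} := by
  simp only [ConsistentA, Set.ofPred_forall]
  refine MeasurableSet.iInter fun i ↦ MeasurableSet.iInter fun _ ↦ ?_
  have h1 : MeasurableSet {ra : π.Pub × π.PrivA | π.turn ra.1 (s.take i) = some Player.alice} :=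
    measurable_fst (π.measurableSet_turn _ _)
  have h2 := π.measurableSet_bitA (s.take i) x
  have h3 : MeasurableSet {ra : π.Pub × π.PrivA | some (π.bitA ra.1 (s.take i) x ra.2) = s[i]?} := by
    rcases s[i]? with _ | _ | _
    · simp
    · simpa [Set.compl_ofPred] using h2.compl
    · simpa using h2
  exact h1.imp h3

lemma measurableSet_consistentB (s : List Bool) (y : Y) :
    MeasurableSet {rb : π.Pub × π.PrivB | π.ConsistentB rb.1 s y rb.2} := by
  simp only [ConsistentB, Set.ofPred_forall]
  refine MeasurableSet.iInter fun i ↦ MeasurableSet.iInter fun _ ↦ ?_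
  have h1 : MeasurableSet {rb : π.Pub × π.PrivB | π.turn rb.1 (s.take i) = some Player.bob} :=
    measurable_fst (π.measurableSet_turn _ _)
  have h2 := π.measurableSet_bitB (s.take i) y
  have h3 : MeasurableSet {rb : π.Pub × π.PrivB | some (π.bitB rb.1 (s.take i) y rb.2) = s[i]?} := by
    rcases s[i]? with _ | _ | _
    · simp
    · simpa [Set.compl_ofPred] using h2.compl
    · simpa using h2
  exact h1.imp h3

lemma measurable_bits (xy : X × Y) : Measurable (π.bits xy) := by
  refine measurable_to_countable' fun s ↦ ?_
  have : π.bits xy ⁻¹' {s} = {ρ | π.Ended ρ.1 s} ∩ ({ρ | π.ConsistentA ρ.1 s xy.1 ρ.2.1} ∩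
      {ρ | π.ConsistentB ρ.1 s xy.2 ρ.2.2}) := by
    ext ρ
    exact π.bits_eq_iff
  rw [this]
  refine (measurable_fst (π.measurableSet_ended s)).inter (MeasurableSet.inter ?_ ?_)
  · exact (measurable_fst.prodMk (measurable_fst.comp measurable_snd))
      (π.measurableSet_consistentA s xy.1)
  · exact (measurable_fst.prodMk (measurable_snd.comp measurable_snd))
      (π.measurableSet_consistentB s xy.2)

end Run

/-! ### The product form of the transcript densities -/

section Density

/-- The probability that Alice's bits in the transcript are those in `s`. -/
noncomputable def weightA (x : X) (t : π.Pub × List Bool) : ℝ :=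
  π.privALaw.real {a | π.ConsistentA t.1 t.2 x a}

/-- The probability that Bob's bits in the transcript are those in `s`. -/
noncomputable def weightB (y : Y) (t : π.Pub × List Bool) : ℝ :=
  π.privBLaw.real {b | π.ConsistentB t.1 t.2 y b}

/-- The density of the law of the transcript on the input `xy`. -/
noncomputable def density (xy : X × Y) : π.Pub × List Bool → ℝ :=
  {t | π.Ended t.1 t.2}.indicator fun t ↦ π.weightA xy.1 t * π.weightB xy.2 t

/-- The reference measure on the transcripts. -/
noncomputable abbrev transcriptMeasure : Measure (π.Pub × List Bool) :=
  π.pubLaw.prod Measure.count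

/-- The transcript of an execution. -/
def transcript (xy : X × Y) (ρ : π.Rand) : π.Pub × List Bool := (ρ.1, π.bits xy ρ)

lemma measurable_transcript (xy : X × Y) : Measurable (π.transcript xy) :=
  measurable_fst.prodMk (π.measurable_bits xy)

lemma measurable_weightA (x : X) : Measurable (π.weightA x) :=
  measurable_from_prod_countable_left fun s ↦
    (measurable_measure_prodMk_left (π.measurableSet_consistentA s x)).ennreal_toReal

lemma measurable_weightB (y : Y) : Measurable (π.weightB y) :=
  measurable_from_prod_countable_left fun s ↦
    (measurable_measure_prodMk_left (π.measurableSet_consistentB s y)).ennreal_toReal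

lemma measurableSet_of_sections {A : Type*} [MeasurableSpace A] {B : Set (A × List Bool)}
    (h : ∀ s, MeasurableSet {a | (a, s) ∈ B}) : MeasurableSet B := by
  have : Measurable fun x ↦ (x ∈ B : Prop) :=
    measurable_from_prod_countable_left fun s ↦ measurable_mem.2 (h s)
  exact measurableSet_setOfPred.2 this

lemma measurable_density (xy : X × Y) : Measurable (π.density xy) :=
  ((π.measurable_weightA _).mul (π.measurable_weightB _)).indicator
    (measurableSet_of_sections fun s ↦ π.measurableSet_ended s)

lemma density_nonneg (xy : X × Y) (t : π.Pub × List Bool) : 0 ≤ π.density xy t :=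
  Set.indicator_nonneg (fun _ _ ↦ mul_nonneg measureReal_nonneg measureReal_nonneg) _

/-- For a fixed public string the event is a product set in the two private strings, so its
probability factors. -/
lemma ofReal_density (xy : X × Y) (r : π.Pub) (s : List Bool) :
    ENNReal.ofReal (π.density xy (r, s)) =
      π.privALaw.prod π.privBLaw {ab | π.bits xy (r, ab) = s} := by
  by_cases h : π.Ended r s
  · have : {ab : π.PrivA × π.PrivB | π.bits xy (r, ab) = s} =
        {a | π.ConsistentA r s xy.1 a} ×ˢ {b | π.ConsistentB r s xy.2 b} := by
      ext ab
      simp [bits_eq_iff, h]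
    rw [this, Measure.prod_prod, density, Set.indicator_of_mem (by exact h), weightA, weightB,
      ENNReal.ofReal_mul measureReal_nonneg, ofReal_measureReal, ofReal_measureReal]
  · have : {ab : π.PrivA × π.PrivB | π.bits xy (r, ab) = s} = ∅ := by
      ext ab
      simp [bits_eq_iff, h]
    rw [this, density, Set.indicator_of_notMem (by exact h)]
    simp

lemma map_transcript (xy : X × Y) :
    π.randLaw.map (π.transcript xy) =
      π.transcriptMeasure.withDensity fun t ↦ ENNReal.ofReal (π.density xy t) := by
  ext B hB
  rw [Measure.map_apply (π.measurable_transcript xy) hB, withDensity_apply _ hB,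
    ← lintegral_indicator hB, lintegral_prod _
      ((π.measurable_density xy).ennreal_ofReal.indicator hB).aemeasurable,
    Measure.prod_apply (π.measurable_transcript xy hB)]
  refine lintegral_congr fun r ↦ ?_
  rw [lintegral_count]
  have hU : Prod.mk r ⁻¹' (π.transcript xy ⁻¹' B) =
      ⋃ s : List Bool, {ab | π.bits xy (r, ab) = s ∧ (r, s) ∈ B} := by
    ext ab
    simp [transcript]
  have hbits : Measurable fun ab ↦ π.bits xy (r, ab) :=
    (π.measurable_bits xy).comp measurable_prodMk_left
  rw [hU, measure_iUnion]
  · refine tsum_congr fun s ↦ ?_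
    by_cases h : (r, s) ∈ B
    · simp [h, ofReal_density]
    · simp [h]
  · intro s s' hss
    refine Set.disjoint_left.2 fun ab h h' ↦ hss (h.1.symm.trans h'.1)
  · intro s
    by_cases h : (r, s) ∈ B
    · simp only [h, and_true]
      exact hbits (measurableSet_singleton s)
    · simp [h]

lemma integrable_density (xy : X × Y) : Integrable (π.density xy) π.transcriptMeasure :=
  CommInfo.integrable_density π.measurable_transcript π.measurable_density π.density_nonneg
    π.map_transcript xy

lemma integral_density (xy : X × Y) : ∫ t, π.density xy t ∂π.transcriptMeasure = 1 :=
  CommInfo.integral_density π.measurable_transcript π.measurable_density π.density_nonneg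
    π.map_transcript xy

lemma measurableSet_output_ne (z : Z) :
    MeasurableSet {t : π.Pub × List Bool | π.output t.1 t.2 ≠ z} :=
  measurableSet_of_sections fun s ↦ (π.measurableSet_output s z).compl

lemma measureReal_result_ne (xy : X × Y) (z : Z) :
    π.randLaw.real {ρ | π.result xy ρ ≠ z} =
      ∫ t in {t | π.output t.1 t.2 ≠ z}, π.density xy t ∂π.transcriptMeasure := by
  have h := Measure.map_apply (μ := π.randLaw) (π.measurable_transcript xy)
    (π.measurableSet_output_ne z)
  rw [integral_eq_lintegral_of_nonneg_ae (.of_forall (π.density_nonneg xy))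
    (π.measurable_density xy).aestronglyMeasurable,
    ← withDensity_apply _ (π.measurableSet_output_ne z), ← map_transcript, h]
  rfl

lemma density_eq_zero_of_performs {f : X × Y → Z} (hπ : π.Performs f 0) (xy : X × Y) :
    ∀ᵐ t ∂π.transcriptMeasure, π.output t.1 t.2 ≠ f xy → π.density xy t = 0 := by
  have h0 : ∫ t in {t | π.output t.1 t.2 ≠ f xy}, π.density xy t ∂π.transcriptMeasure = 0 :=
    le_antisymm ((π.measureReal_result_ne xy _).symm.trans_le (hπ xy))
      (setIntegral_nonneg (π.measurableSet_output_ne _) fun t _ ↦ π.density_nonneg xy t)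
  rw [setIntegral_eq_zero_iff_of_nonneg_ae (.of_forall (π.density_nonneg xy))
    (π.integrable_density xy).integrableOn] at h0
  exact (ae_restrict_iff' (π.measurableSet_output_ne _)).1 h0

/-- Rectangle property: the first hypothesis makes Alice's factor at `x` positive, the second Bob's
factor at `y'`. -/
lemma density_cross_pos {x x' : X} {y y' : Y} {t : π.Pub × List Bool}
    (h : 0 < π.density (x, y) t) (h' : 0 < π.density (x', y') t) :
    0 < π.density (x, y') t := by
  have ht : t ∈ {t : π.Pub × List Bool | π.Ended t.1 t.2} := by
    by_contra hn
    simp [density, Set.indicator_of_notMem hn] at h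
  simp only [density, Set.indicator_of_mem ht] at h h' ⊢
  exact mul_pos (pos_of_mul_pos_left h measureReal_nonneg)
    (pos_of_mul_pos_right h' measureReal_nonneg)

end Density

/-! ### Information cost as lost residual entropy -/

section InfoCost

variable [Fintype X] [Fintype Y] [MeasurableSpace X] [MeasurableSpace Y]

/-- The uncertainty (in nats) that remains about the inputs after the transcript `t`, scaled by
the density of `t`. -/
noncomputable def residual (μ : Measure (X × Y)) (p : X × Y → ℝ) : ℝ :=
  ∑ y, massEntropy (fun x ↦ μ.real {(x, y)} * p (x, y)) +
    ∑ x, massEntropy (fun y ↦ μ.real {(x, y)} * p (x, y))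

lemma integrable_residual (μ : Measure (X × Y)) :
    Integrable (fun t ↦ residual μ fun xy ↦ π.density xy t) π.transcriptMeasure := by
  have h1 := integrable_massEntropy_jointMass (μ := μ) π.measurable_transcript
    π.measurable_density π.density_nonneg π.map_transcript (Equiv.refl _)
  have h2 := integrable_massEntropy_jointMass (μ := μ) π.measurable_transcript
    π.measurable_density π.density_nonneg π.map_transcript (Equiv.prodComm _ _)
  exact (integrable_finsetSum _ fun y _ ↦ h1 y).add (integrable_finsetSum _ fun x _ ↦ h2 x)

variable [DiscreteMeasurableSpace X] [DiscreteMeasurableSpace Y]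
  (μ : Measure (X × Y)) [IsProbabilityMeasure μ]

/-- Only the integral depends on the protocol, so lowering the cost means raising the average
residual entropy. -/
lemma infoCost_eq : π.infoCost μ =
    (residual μ 1 - ∫ t, residual μ (fun xy ↦ π.density xy t) ∂π.transcriptMeasure) /
      Real.log 2 := by
  have h1 := integrable_massEntropy_jointMass (μ := μ) π.measurable_transcript
    π.measurable_density π.density_nonneg π.map_transcript (Equiv.refl _)
  have h2 := integrable_massEntropy_jointMass (μ := μ) π.measurable_transcript
    π.measurable_density π.density_nonneg π.map_transcript (Equiv.prodComm _ _)
  have hT : π.transcriptAlg = MeasurableSpace.comap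
      (fun ω : (X × Y) × π.Rand ↦ π.transcript ω.1 ω.2) inferInstance := by
    rw [show (inferInstance : MeasurableSpace (π.Pub × List Bool)) = MeasurableSpace.prod _ _
      from rfl, MeasurableSpace.prod, MeasurableSpace.comap_sup, MeasurableSpace.comap_comp,
      MeasurableSpace.comap_comp]
    rfl
  have e1 := condEntropy_eq_integral (μ := μ) π.measurable_transcript
    π.measurable_density π.density_nonneg π.map_transcript (Equiv.refl _)
  have e2 := condEntropy_eq_integral (μ := μ) π.measurable_transcript
    π.measurable_density π.density_nonneg π.map_transcript (Equiv.prodComm _ _)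
  have i1 := condEntropy_input (μ := μ) (Q := π.randLaw) (Equiv.refl _)
  have i2 := condEntropy_input (μ := μ) (Q := π.randLaw) (Equiv.prodComm _ _)
  rw [← hT] at e1 e2
  have hint : ∫ t, residual μ (fun xy ↦ π.density xy t) ∂π.transcriptMeasure =
      ∫ t, ∑ y, massEntropy (jointMass μ π.density (Equiv.refl _) t y) ∂π.transcriptMeasure +
      ∫ t, ∑ x, massEntropy (jointMass μ π.density (Equiv.prodComm _ _) t x)
        ∂π.transcriptMeasure :=
    integral_add (integrable_finsetSum _ fun y _ ↦ h1 y) (integrable_finsetSum _ fun x _ ↦ h2 x)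
  have hone : residual μ 1 = (∑ y, massEntropy fun x ↦ μ.real {(Equiv.refl (X × Y)).symm (x, y)}) +
      ∑ x, massEntropy fun y ↦ μ.real {(Equiv.prodComm X Y).symm (y, x)} := by
    simp [residual]
  rw [infoCost, condMutualInfo, condMutualInfo, hint, hone]
  refine (congrArg₂ (· + ·) (congrArg₂ (· - ·) i1 e1) (congrArg₂ (· - ·) i2 e2)).trans ?_
  ring

end InfoCost

end Protocol

/-! ### Entropy created by mixing likelihoods -/

section Blend

lemma massEntropy_blend {ι : Type*} [Fintype ι] {m n : ι → ℝ} {ε : ℝ} (hε : ε ≤ 1)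
    (hm : ∀ i, 0 ≤ m i) (hmn : ∀ i, (1 - ε) * m i ≤ n i) (i : ι) :
    (1 - ε) * massEntropy m + (n i - (1 - ε) * m i) * Real.log ((∑ j, n j) / n i) ≤
      massEntropy n := by
  rw [← massEntropy_smul]
  exact massEntropy_add_le (fun i ↦ mul_nonneg (by linarith) (hm i)) hmn i

lemma massEntropy_blend_le {ι : Type*} [Fintype ι] {m n : ι → ℝ} {ε : ℝ} (hε : ε ≤ 1)
    (hm : ∀ i, 0 ≤ m i) (hmn : ∀ i, (1 - ε) * m i ≤ n i) :
    (1 - ε) * massEntropy m ≤ massEntropy n := by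
  rw [← massEntropy_smul]
  exact massEntropy_mono (fun i ↦ mul_nonneg (by linarith) (hm i)) hmn

/-- If `j` is nearly excluded in the presence of `i`, then moving the fraction `ε` of the
likelihood of `i` to `j` creates entropy. -/
lemma massEntropy_blend_gain {ι : Type*} [Fintype ι] {μ p n : ι → ℝ} {ε : ℝ} (hε0 : 0 < ε)
    (hε : ε ≤ 1) (hμ : ∀ i, 0 ≤ μ i) (hp : ∀ i, 0 ≤ p i)
    (hn : ∀ i, (1 - ε) * p i ≤ n i) {i j : ι} (hi : n i = p i)
    (hj : n j = (1 - ε) * p j + ε * p i) (hμi : 0 < μ i) (hμj : 0 < μ j) (hμj1 : μ j ≤ 1)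
    (hle : p j ≤ ε * p i) :
    (1 - ε) * massEntropy (fun k ↦ μ k * p k) + ε * μ j * Real.log (μ i / (2 * ε)) * p i ≤
      massEntropy (fun k ↦ μ k * n k) := by
  have hn0 : ∀ k, 0 ≤ n k := fun k ↦ (mul_nonneg (by linarith) (hp k)).trans (hn k)
  have h := massEntropy_blend (n := fun k ↦ μ k * n k) hε (fun k ↦ mul_nonneg (hμ k) (hp k))
    (fun k ↦ by nlinarith [hn k, hμ k]) j
  refine le_trans (add_le_add_right ?_ _) h
  have hs : μ j * n j - (1 - ε) * (μ j * p j) = ε * μ j * p i := by rw [hj]; ring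
  rw [hs, mul_right_comm]
  rcases (hp i).eq_or_lt with h0 | hpos
  · simp [← h0]
  refine mul_le_mul_of_nonneg_left ?_ (by positivity)
  have hnj : 0 < n j := by rw [hj]; nlinarith [hp j, mul_pos hε0 hpos]
  -- Both parts of the mixture are at most `ε * p i`. Hence the posterior of `j` is at most `2 * ε /
  -- μ i`, and its surprisal at least the logarithm claimed.
  have hnj2 : n j ≤ 2 * ε * p i := by rw [hj]; nlinarith [hp j]
  refine Real.log_le_log (by positivity) ?_
  rw [div_le_div_iff₀ (by positivity) (by positivity)]
  have hsum : μ i * p i ≤ ∑ k, μ k * n k := by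
    rw [← hi]
    exact Finset.single_le_sum (f := fun k ↦ μ k * n k) (fun k _ ↦ mul_nonneg (hμ k) (hn0 k))
      (Finset.mem_univ i)
  calc μ i * (μ j * n j) ≤ μ i * (1 * (2 * ε * p i)) := by gcongr
    _ = μ i * p i * (2 * ε) := by ring
    _ ≤ _ := by gcongr

lemma add_sub_le_sum {ι : Type*} [Fintype ι] {F G : ι → ℝ} (h : ∀ i, F i ≤ G i) (i : ι) {g : ℝ}
    (hi : F i + g ≤ G i) : ∑ i, F i + g ≤ ∑ i, G i := by
  have h1 : G i - F i ≤ ∑ i, (G i - F i) :=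
    Finset.single_le_sum (f := fun i ↦ G i - F i) (fun i _ ↦ sub_nonneg.2 (h i))
      (Finset.mem_univ i)
  rw [Finset.sum_sub_distrib] at h1
  linarith

end Blend

namespace Protocol

section Residual

variable {X : Type u} {Y : Type v} [Fintype X] [Fintype Y] [MeasurableSpace X]
  [MeasurableSpace Y] {μ : Measure (X × Y)}

lemma residual_nonneg {p : X × Y → ℝ} (hp : ∀ xy, 0 ≤ p xy) : 0 ≤ residual μ p :=
  add_nonneg
    (Finset.sum_nonneg fun _ _ ↦ massEntropy_nonneg fun _ ↦ mul_nonneg measureReal_nonneg (hp _))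
    (Finset.sum_nonneg fun _ _ ↦ massEntropy_nonneg fun _ ↦ mul_nonneg measureReal_nonneg (hp _))

lemma residual_le {p : X × Y → ℝ} (hp : ∀ xy, 0 ≤ p xy) :
    residual μ p ≤ (Fintype.card X + Fintype.card Y) * ∑ xy, μ.real {xy} * p xy := by
  rw [residual, add_mul]
  gcongr
  · rw [Fintype.sum_prod_type_right, Finset.mul_sum]
    exact Finset.sum_le_sum fun _ _ ↦
      massEntropy_le_card_mul fun _ ↦ mul_nonneg measureReal_nonneg (hp _)
  · rw [Fintype.sum_prod_type, Finset.mul_sum]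
    exact Finset.sum_le_sum fun _ _ ↦
      massEntropy_le_card_mul fun _ ↦ mul_nonneg measureReal_nonneg (hp _)

variable {p p' : X × Y → ℝ} {ε : ℝ}

lemma residual_blend_le (hε : ε ≤ 1) (hp : ∀ xy, 0 ≤ p xy)
    (hpp : ∀ xy, (1 - ε) * p xy ≤ p' xy) : (1 - ε) * residual μ p ≤ residual μ p' := by
  have key : ∀ xy, (1 - ε) * (μ.real {xy} * p xy) ≤ μ.real {xy} * p' xy := fun xy ↦ by
    nlinarith [hpp xy, measureReal_nonneg (μ := μ) (s := {xy})]
  rw [residual, residual, mul_add, Finset.mul_sum, Finset.mul_sum]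
  exact add_le_add
    (Finset.sum_le_sum fun y _ ↦ massEntropy_blend_le hε
      (fun x ↦ mul_nonneg measureReal_nonneg (hp _)) fun x ↦ key _)
    (Finset.sum_le_sum fun x _ ↦ massEntropy_blend_le hε
      (fun x ↦ mul_nonneg measureReal_nonneg (hp _)) fun x ↦ key _)

/-- The gain is credited once, to the row or column shared by `a` and `b`; every other line keeps at
least the fraction `1 - ε` of its entropy. -/
lemma residual_blend_gain [IsProbabilityMeasure μ] (hε0 : 0 < ε) (hε : ε ≤ 1)
    (hp : ∀ xy, 0 ≤ p xy) (hpp : ∀ xy, (1 - ε) * p xy ≤ p' xy) {a b : X × Y}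
    (hab : a.1 = b.1 ∨ a.2 = b.2) (ha : p' a = p a) (hb : p' b = (1 - ε) * p b + ε * p a)
    (hμa : 0 < μ.real {a}) (hμb : 0 < μ.real {b}) (hle : p b ≤ ε * p a) :
    (1 - ε) * residual μ p + ε * μ.real {b} * Real.log (μ.real {a} / (2 * ε)) * p a ≤
      residual μ p' := by
  have key : ∀ xy, (1 - ε) * (μ.real {xy} * p xy) ≤ μ.real {xy} * p' xy := fun xy ↦ by
    nlinarith [hpp xy, measureReal_nonneg (μ := μ) (s := {xy})]
  have h1 : ∀ y, (1 - ε) * massEntropy (fun x ↦ μ.real {(x, y)} * p (x, y)) ≤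
      massEntropy (fun x ↦ μ.real {(x, y)} * p' (x, y)) := fun y ↦ massEntropy_blend_le hε
      (fun x ↦ mul_nonneg measureReal_nonneg (hp _)) fun x ↦ key _
  have h2 : ∀ x, (1 - ε) * massEntropy (fun y ↦ μ.real {(x, y)} * p (x, y)) ≤
      massEntropy (fun y ↦ μ.real {(x, y)} * p' (x, y)) := fun y ↦ massEntropy_blend_le hε
      (fun x ↦ mul_nonneg measureReal_nonneg (hp _)) fun x ↦ key _
  rw [residual, residual, mul_add, Finset.mul_sum, Finset.mul_sum]
  obtain ⟨x, y⟩ := a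
  obtain ⟨x', y'⟩ := b
  rcases hab with h | h
  · simp only at h
    subst h
    rw [add_assoc]
    refine add_le_add (Finset.sum_le_sum fun y _ ↦ h1 y) (add_sub_le_sum h2 x ?_)
    exact massEntropy_blend_gain (μ := fun y ↦ μ.real {(x, y)}) (p := fun y ↦ p (x, y))
      (n := fun y ↦ p' (x, y)) hε0 hε (fun _ ↦ measureReal_nonneg) (fun _ ↦ hp _)
      (fun _ ↦ hpp _) ha hb hμa hμb measureReal_le_one hle
  · simp only at h
    subst h
    rw [add_right_comm]
    refine add_le_add (add_sub_le_sum h1 y ?_) (Finset.sum_le_sum fun y _ ↦ h2 y)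
    exact massEntropy_blend_gain (μ := fun x ↦ μ.real {(x, y)}) (p := fun x ↦ p (x, y))
      (n := fun x ↦ p' (x, y)) hε0 hε (fun _ ↦ measureReal_nonneg) (fun _ ↦ hp _)
      (fun _ ↦ hpp _) ha hb hμa hμb measureReal_le_one hle

end Residual

/-! ### The perturbed protocol and its cost -/

section Perturb

variable {X : Type u} {Y : Type v} {Z : Type w}

/-- Each player tosses a private coin with law `ν` and, on heads, replaces the input `x` by `σ x`,
or `y` by `σ' y`, before running `π`. -/
noncomputable def perturb (π : Protocol X Y Z) (σ : X → X) (σ' : Y → Y) (ν : Measure Bool)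
    [IsProbabilityMeasure ν] : Protocol X Y Z where
  Pub := π.Pub
  PrivA := π.PrivA × Bool
  PrivB := π.PrivB × Bool
  pubLaw := π.pubLaw
  privALaw := π.privALaw.prod ν
  privBLaw := π.privBLaw.prod ν
  turn := π.turn
  bitA r s x a := π.bitA r s (bif a.2 then σ x else x) a.1
  bitB r s y b := π.bitB r s (bif b.2 then σ' y else y) b.1
  output := π.output
  maxBits := π.maxBits
  turn_eq_none := π.turn_eq_none
  measurableSet_turn := π.measurableSet_turn
  measurableSet_bitA s x := by
    have : Measurable fun q : (π.Pub × π.PrivA) × Bool ↦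
        π.bitA q.1.1 s (bif q.2 then σ x else x) q.1.2 = true :=
      measurable_from_prod_countable_left fun c ↦ measurableSet_setOfPred.1
        (π.measurableSet_bitA s (bif c then σ x else x))
    exact measurableSet_setOfPred.2
      (this.comp ((measurable_fst.prodMk (measurable_fst.comp measurable_snd)).prodMk
        (measurable_snd.comp measurable_snd)))
  measurableSet_bitB s y := by
    have : Measurable fun q : (π.Pub × π.PrivB) × Bool ↦
        π.bitB q.1.1 s (bif q.2 then σ' y else y) q.1.2 = true :=
      measurable_from_prod_countable_left fun c ↦ measurableSet_setOfPred.1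
        (π.measurableSet_bitB s (bif c then σ' y else y))
    exact measurableSet_setOfPred.2
      (this.comp ((measurable_fst.prodMk (measurable_fst.comp measurable_snd)).prodMk
        (measurable_snd.comp measurable_snd)))
  measurableSet_output := π.measurableSet_output

lemma measureReal_prod_bool {A : Type*} [MeasurableSpace A] (P : Measure A)
    [IsProbabilityMeasure P] (ν : Measure Bool) [IsProbabilityMeasure ν] {B : Set (A × Bool)}
    (hB : MeasurableSet B) :
    (P.prod ν).real B = (1 - ν.real {true}) * P.real {a | (a, false) ∈ B} +
      ν.real {true} * P.real {a | (a, true) ∈ B} := by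
  have hν : ν.real {false} = 1 - ν.real {true} := by
    rw [← probReal_compl_eq_one_sub (measurableSet_singleton _)]
    congr 1
    ext b
    cases b <;> simp
  rw [measureReal_def, Measure.prod_apply_symm hB, lintegral_fintype, Fintype.sum_bool,
    ENNReal.toReal_add (ENNReal.mul_ne_top (measure_ne_top _ _) (measure_ne_top _ _))
      (ENNReal.mul_ne_top (measure_ne_top _ _) (measure_ne_top _ _)), ENNReal.toReal_mul,
    ENNReal.toReal_mul, ← hν, add_comm, mul_comm, mul_comm (P _).toReal]
  rfl

variable (π : Protocol X Y Z) (σ : X → X) (σ' : Y → Y) (ν : Measure Bool)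
    [IsProbabilityMeasure ν]

lemma weightA_perturb (x : X) (t : π.Pub × List Bool) :
    (π.perturb σ σ' ν).weightA x t =
      (1 - ν.real {true}) * π.weightA x t + ν.real {true} * π.weightA (σ x) t :=
  measureReal_prod_bool π.privALaw ν
    (measurable_prodMk_left ((π.perturb σ σ' ν).measurableSet_consistentA t.2 x))

lemma weightB_perturb (y : Y) (t : π.Pub × List Bool) :
    (π.perturb σ σ' ν).weightB y t =
      (1 - ν.real {true}) * π.weightB y t + ν.real {true} * π.weightB (σ' y) t :=
  measureReal_prod_bool π.privBLaw ν
    (measurable_prodMk_left ((π.perturb σ σ' ν).measurableSet_consistentB t.2 y))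

/-- With one substitution trivial, only one factor of the product is a mixture, so the product is a
mixture of two densities without cross terms. -/
lemma density_perturb (h : σ = id ∨ σ' = id) (xy : X × Y) (t : π.Pub × List Bool) :
    (π.perturb σ σ' ν).density xy t =
      (1 - ν.real {true}) * π.density xy t +
        ν.real {true} * π.density (σ xy.1, σ' xy.2) t := by
  by_cases ht : π.Ended t.1 t.2
  · have h1 : (π.perturb σ σ' ν).density xy t =
        (π.perturb σ σ' ν).weightA xy.1 t * (π.perturb σ σ' ν).weightB xy.2 t :=
      Set.indicator_of_mem (by exact ht) _
    have h2 : ∀ xy, π.density xy t = π.weightA xy.1 t * π.weightB xy.2 t := fun xy ↦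
      Set.indicator_of_mem (by exact ht) _
    rw [h1, h2, h2, weightA_perturb, weightB_perturb]
    rcases h with rfl | rfl <;> simp only [id] <;> ring
  · have h1 : (π.perturb σ σ' ν).density xy t = 0 := Set.indicator_of_notMem (by exact ht) _
    have h2 : ∀ xy, π.density xy t = 0 := fun xy ↦ Set.indicator_of_notMem (by exact ht) _
    rw [h1, h2, h2]
    ring

/-- On tails the run is that of the error-free protocol; on heads, of probability `ν.real {true}`,
the error is bounded by 1. -/
lemma performs_perturb (h : σ = id ∨ σ' = id) {f : X × Y → Z} (hπ : π.Performs f 0) :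
    (π.perturb σ σ' ν).Performs f (ν.real {true}) := by
  intro xy
  rw [measureReal_result_ne]
  have hd := funext fun t ↦ π.density_perturb σ σ' ν h xy t
  have hint := π.integrable_density
  have h0 : ∫ t in {t | π.output t.1 t.2 ≠ f xy}, π.density xy t ∂π.transcriptMeasure ≤ 0 :=
    (π.measureReal_result_ne xy _).symm.trans_le (hπ xy)
  have h1 : ∫ t in {t | π.output t.1 t.2 ≠ f xy}, π.density (σ xy.1, σ' xy.2) t
      ∂π.transcriptMeasure ≤ 1 :=
    (setIntegral_le_integral (hint _) (.of_forall (π.density_nonneg _))).trans_eq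
      (π.integral_density _)
  have hν1 : ν.real {true} ≤ 1 := measureReal_le_one
  have hν0 : 0 ≤ ν.real {true} := measureReal_nonneg
  calc _ = ∫ t in {t | π.output t.1 t.2 ≠ f xy}, ((1 - ν.real {true}) * π.density xy t +
        ν.real {true} * π.density (σ xy.1, σ' xy.2) t) ∂π.transcriptMeasure := by
        rw [hd]; rfl
    _ = (1 - ν.real {true}) * ∫ t in {t | π.output t.1 t.2 ≠ f xy}, π.density xy t
          ∂π.transcriptMeasure + ν.real {true} *
        ∫ t in {t | π.output t.1 t.2 ≠ f xy}, π.density (σ xy.1, σ' xy.2) t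
          ∂π.transcriptMeasure := by
        rw [integral_add ((hint _).integrableOn.const_mul _) ((hint _).integrableOn.const_mul _),
          integral_const_mul, integral_const_mul]
    _ ≤ ν.real {true} := by nlinarith

lemma exists_coin {ε : ℝ} (h0 : 0 ≤ ε) (h1 : ε ≤ 1) :
    ∃ ν : Measure Bool, IsProbabilityMeasure ν ∧ ν.real {true} = ε := by
  refine ⟨ENNReal.ofReal (1 - ε) • Measure.dirac false + ENNReal.ofReal ε • Measure.dirac true,
    ⟨?_⟩, ?_⟩
  · simp [← ENNReal.ofReal_add (sub_nonneg.2 h1) h0]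
  · simp [measureReal_def, h0]

/-- The probability, on the input `a`, that the likelihood of the transcript on the input `b` is at
most `δ` times its likelihood on `a`. -/
noncomputable def exclusion (a b : X × Y) (δ : ℝ) : ℝ :=
  ∫ t in {t | π.density b t ≤ δ * π.density a t}, π.density a t ∂π.transcriptMeasure

lemma measurableSet_density_le (a b : X × Y) (δ : ℝ) :
    MeasurableSet {t | π.density b t ≤ δ * π.density a t} :=
  measurableSet_le (π.measurable_density b) ((π.measurable_density a).const_mul δ)

lemma exclusion_mono (a b : X × Y) {δ δ' : ℝ} (h : δ ≤ δ') :
    π.exclusion a b δ ≤ π.exclusion a b δ' :=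
  setIntegral_mono_set (π.integrable_density a).integrableOn
    (.of_forall (π.density_nonneg a))
    (LE.le.eventuallyLE fun t ht ↦ by
      have ht' : π.density b t ≤ δ * π.density a t := ht
      exact ht'.trans (mul_le_mul_of_nonneg_right h (π.density_nonneg a t)))

variable [Fintype X] [Fintype Y] [MeasurableSpace X] [MeasurableSpace Y]
  (μ : Measure (X × Y)) [IsProbabilityMeasure μ]

lemma integral_residual_perturb {a b : X × Y} (hab : a.1 = b.1 ∨ a.2 = b.2)
    (h : σ = id ∨ σ' = id) (ha : (σ a.1, σ' a.2) = a) (hb : (σ b.1, σ' b.2) = a)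
    (hμa : 0 < μ.real {a}) (hμb : 0 < μ.real {b}) (hν : 0 < ν.real {true}) :
    (1 - ν.real {true}) * ∫ t, residual μ (fun xy ↦ π.density xy t) ∂π.transcriptMeasure +
      ν.real {true} * μ.real {b} * Real.log (μ.real {a} / (2 * ν.real {true})) *
        π.exclusion a b (ν.real {true}) ≤
    ∫ t, residual μ (fun xy ↦ (π.perturb σ σ' ν).density xy t)
      ∂(π.perturb σ σ' ν).transcriptMeasure := by
  set ε := ν.real {true} with hε
  have hν1 : ε ≤ 1 := measureReal_le_one
  have hd := π.density_perturb σ σ' ν h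
  rw [exclusion, ← integral_indicator (π.measurableSet_density_le a b ε), ← integral_const_mul,
    ← integral_const_mul, ← integral_add ((π.integrable_residual μ).const_mul _)
      (((π.integrable_density a).indicator (π.measurableSet_density_le a b ε)).const_mul _)]
  refine integral_mono (((π.integrable_residual μ).const_mul _).add
    (((π.integrable_density a).indicator (π.measurableSet_density_le a b ε)).const_mul _))
    ((π.perturb σ σ' ν).integrable_residual μ) fun t ↦ ?_
  have hpp : ∀ xy, (1 - ε) * π.density xy t ≤ (π.perturb σ σ' ν).density xy t := fun xy ↦ by
    rw [hd xy t]
    exact le_add_of_nonneg_right (mul_nonneg hν.le (π.density_nonneg _ _))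
  by_cases hle : π.density b t ≤ ε * π.density a t
  · simp only [Set.indicator_of_mem (show t ∈ {t | π.density b t ≤ ε * π.density a t} from hle)]
    refine residual_blend_gain hν hν1 (fun xy ↦ π.density_nonneg xy t) hpp hab ?_ ?_ hμa hμb hle
    · rw [hd, ha]; ring
    · rw [hd, hb]
  · simp only [Set.indicator_of_notMem
      (show t ∉ {t | π.density b t ≤ ε * π.density a t} from hle), mul_zero, add_zero]
    exact residual_blend_le hν1 (fun xy ↦ π.density_nonneg xy t) hpp

variable [DiscreteMeasurableSpace X] [DiscreteMeasurableSpace Y]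

lemma integral_residual_le :
    ∫ t, residual μ (fun xy ↦ π.density xy t) ∂π.transcriptMeasure ≤
      Fintype.card X + Fintype.card Y := by
  have hint := π.integrable_density
  have hμ : ∑ xy, μ.real {xy} = 1 := by simp
  calc _ ≤ ∫ t, (Fintype.card X + Fintype.card Y) * ∑ xy, μ.real {xy} * π.density xy t
        ∂π.transcriptMeasure :=
        integral_mono (π.integrable_residual μ)
          ((integrable_finsetSum _ fun xy _ ↦ (hint xy).const_mul _).const_mul _)
          fun t ↦ residual_le fun xy ↦ π.density_nonneg xy t
    _ = Fintype.card X + Fintype.card Y := by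
        rw [integral_const_mul, integral_finsetSum _ fun xy _ ↦ (hint xy).const_mul _]
        simp only [integral_const_mul, integral_density, mul_one, hμ]

/-- A bound uniform in the protocol, so that the infimum defining `IC` is over a set bounded below.
-/
lemma infoCost_ge :
    (residual μ 1 - (Fintype.card X + Fintype.card Y)) / Real.log 2 ≤ π.infoCost μ := by
  rw [infoCost_eq]
  gcongr
  exact π.integral_residual_le μ

/-- The loss is `ε` times the old residual entropy, at most `card X + card Y ≤ 2 * card (X × Y)`;
the subtracted term is the entropy created on transcripts that nearly exclude `b`. -/
lemma exists_performs_infoCost_le {f : X × Y → Z} (hπ : π.Performs f 0) {a b : X × Y}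
    (hab : a.1 = b.1 ∨ a.2 = b.2) (hμa : 0 < μ.real {a}) (hμb : 0 < μ.real {b}) {ε : ℝ}
    (hε0 : 0 < ε) (hε1 : ε ≤ 1) :
    ∃ π' : Protocol X Y Z, π'.Performs f ε ∧
      π'.infoCost μ ≤ π.infoCost μ + (2 * Fintype.card (X × Y) * ε -
        ε * μ.real {b} * Real.log (μ.real {a} / (2 * ε)) * π.exclusion a b ε) / Real.log 2 := by
  classical
  obtain ⟨ν, hν, rfl⟩ := exists_coin hε0.le hε1
  obtain ⟨σ, σ', h, ha, hb⟩ : ∃ (σ : X → X) (σ' : Y → Y), (σ = id ∨ σ' = id) ∧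
      (σ a.1, σ' a.2) = a ∧ (σ b.1, σ' b.2) = a := by
    rcases hab with h | h
    -- In a common row only Bob substitutes, in a common column only Alice; a constant substitution
    -- sends `b` to `a` and fixes `a`.
    · exact ⟨id, fun _ ↦ a.2, .inl rfl, rfl, by simp [← h]⟩
    · exact ⟨fun _ ↦ a.1, id, .inr rfl, rfl, by simp [← h]⟩
  refine ⟨π.perturb σ σ' ν, π.performs_perturb σ σ' ν h hπ, ?_⟩
  have key := π.integral_residual_perturb σ σ' ν μ hab h ha hb hμa hμb hε0
  have hJ := π.integral_residual_le μ
  have hX : (Fintype.card X : ℝ) ≤ Fintype.card (X × Y) := by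
    rw [Fintype.card_prod]
    exact_mod_cast Nat.le_mul_of_pos_right _ (Fintype.card_pos_iff.2 ⟨a.2⟩)
  have hY : (Fintype.card Y : ℝ) ≤ Fintype.card (X × Y) := by
    rw [Fintype.card_prod]
    exact_mod_cast Nat.le_mul_of_pos_left _ (Fintype.card_pos_iff.2 ⟨a.1⟩)
  rw [infoCost_eq, infoCost_eq, ← add_div]
  gcongr
  nlinarith

end Perturb

end Protocol

/-! ### Deterministic trees and a protocol that reveals nothing -/

/-- A deterministic protocol tree, without its outputs. -/
inductive ProtocolTree (X : Type u) (Y : Type v)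
  | leaf : ProtocolTree X Y
  | alice (g : X → Bool) (next : Bool → ProtocolTree X Y) : ProtocolTree X Y
  | bob (g : Y → Bool) (next : Bool → ProtocolTree X Y) : ProtocolTree X Y

namespace ProtocolTree

variable {X : Type u} {Y : Type v} {Z : Type w}

/-- The bits transmitted on the input `xy`. -/
def path (xy : X × Y) : ProtocolTree X Y → List Bool
  | leaf => []
  | alice g next => g xy.1 :: path xy (next (g xy.1))
  | bob g next => g xy.2 :: path xy (next (g xy.2))

/-- The subtree that is reached by the bits `s`. -/
def after : ProtocolTree X Y → List Bool → ProtocolTree X Y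
  | t, [] => t
  | leaf, _ :: _ => leaf
  | alice _ next, b :: s => after (next b) s
  | bob _ next, b :: s => after (next b) s

/-- The depth of a tree. -/
def depth : ProtocolTree X Y → ℕ
  | leaf => 0
  | alice _ next => max (depth (next true)) (depth (next false)) + 1
  | bob _ next => max (depth (next true)) (depth (next false)) + 1

lemma after_leaf (s : List Bool) : (leaf : ProtocolTree X Y).after s = leaf := by
  cases s <;> rfl

lemma after_append (t : ProtocolTree X Y) (s s' : List Bool) :
    t.after (s ++ s') = (t.after s).after s' := by
  induction s generalizing t with
  | nil => cases t <;> rfl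
  | cons b s ih =>
    cases t with
    | leaf => rw [after_leaf, after_leaf, after_leaf]
    | alice g next => exact ih _
    | bob g next => exact ih _

lemma depth_after (t : ProtocolTree X Y) (s : List Bool) :
    (t.after s).depth ≤ t.depth - s.length := by
  induction s generalizing t with
  | nil => cases t <;> exact le_rfl
  | cons b s ih =>
    cases t with
    | leaf => simp [after_leaf, depth]
    | alice g next =>
      refine (ih (next b)).trans ?_
      cases b <;> simp only [depth, List.length_cons] <;> omega
    | bob g next =>
      refine (ih (next b)).trans ?_
      cases b <;> simp only [depth, List.length_cons] <;> omega

lemma eq_leaf_of_depth {t : ProtocolTree X Y} (h : t.depth = 0) : t = leaf := by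
  cases t with
  | leaf => rfl
  | alice g next => simp [depth] at h
  | bob g next => simp [depth] at h

/-- The protocol that follows the tree `t`. -/
noncomputable def toProtocol (t : ProtocolTree X Y) (out : List Bool → Z) : Protocol X Y Z where
  Pub := Unit
  PrivA := Unit
  PrivB := Unit
  pubLaw := Measure.dirac ()
  privALaw := Measure.dirac ()
  privBLaw := Measure.dirac ()
  turn _ s := match t.after s with
    | leaf => none
    | alice _ _ => some Player.alice
    | bob _ _ => some Player.bob
  bitA _ s x _ := match t.after s with
    | alice g _ => g x
    | _ => false
  bitB _ s y _ := match t.after s with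
    | bob g _ => g y
    | _ => false
  output _ s := out s
  maxBits := t.depth
  turn_eq_none _ s hs := by
    have h := t.depth_after s
    rw [eq_leaf_of_depth (t := t.after s) (by omega)]
  measurableSet_turn _ _ := .of_discrete
  measurableSet_bitA _ _ := .of_discrete
  measurableSet_bitB _ _ := .of_discrete
  measurableSet_output _ _ := .of_discrete

lemma run_toProtocol (t : ProtocolTree X Y) (out : List Bool → Z) (xy : X × Y)
    (ρ : (t.toProtocol out).Rand) (n : ℕ) (s : List Bool) (hn : (t.after s).depth ≤ n) :
    (t.toProtocol out).run xy ρ n s = s ++ (t.after s).path xy := by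
  induction n generalizing s with
  | zero =>
    rw [eq_leaf_of_depth (Nat.le_zero.1 hn)]
    simp [Protocol.run, path]
  | succ n ih =>
    rcases ht : t.after s with _ | ⟨g, next⟩ | ⟨g, next⟩
    · simp [Protocol.run, toProtocol, ht, path]
    · have hb : ∀ b, t.after (s ++ [b]) = next b := fun b ↦ by
        rw [after_append, ht]
        rcases hnext : next b <;> simp [after, hnext]
      rw [ht, depth] at hn
      have hd : ∀ b, (next b).depth ≤ n := fun b ↦ by cases b <;> omega
      have h := ih (s ++ [g xy.1]) (by rw [hb]; exact hd _)
      rw [hb] at h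
      simpa [Protocol.run, toProtocol, ht, path] using h
    · have hb : ∀ b, t.after (s ++ [b]) = next b := fun b ↦ by
        rw [after_append, ht]
        rcases hnext : next b <;> simp [after, hnext]
      rw [ht, depth] at hn
      have hd : ∀ b, (next b).depth ≤ n := fun b ↦ by cases b <;> omega
      have h := ih (s ++ [g xy.2]) (by rw [hb]; exact hd _)
      rw [hb] at h
      simpa [Protocol.run, toProtocol, ht, path] using h

lemma bits_toProtocol (t : ProtocolTree X Y) (out : List Bool → Z) (xy : X × Y)
    (ρ : (t.toProtocol out).Rand) : (t.toProtocol out).bits xy ρ = t.path xy := by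
  have h0 : t.after [] = t := by cases t <;> rfl
  rw [Protocol.bits, run_toProtocol, h0, List.nil_append]
  rw [h0]
  exact le_rfl

lemma density_toProtocol (t : ProtocolTree X Y) (out : List Bool → Z) (xy : X × Y)
    (s : List Bool) :
    (t.toProtocol out).density xy ((), s) = if t.path xy = s then 1 else 0 := by
  have h := (t.toProtocol out).ofReal_density xy () s
  simp only [bits_toProtocol] at h
  have h2 := congrArg ENNReal.toReal h
  rw [ENNReal.toReal_ofReal (Protocol.density_nonneg _ _ _)] at h2
  refine h2.trans ?_
  split_ifs with hs <;> simp [hs]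

/-- Ask the players the questions in `l` one after the other, and continue according to their
answers. -/
def ask : List ((X → Bool) ⊕ (Y → Bool)) → (List Bool → ProtocolTree X Y) → ProtocolTree X Y
  | [], k => k []
  | .inl g :: l, k => alice g fun b ↦ ask l fun s ↦ k (b :: s)
  | .inr g :: l, k => bob g fun b ↦ ask l fun s ↦ k (b :: s)

/-- The answer to a question on the input `xy`. -/
def answer (xy : X × Y) : (X → Bool) ⊕ (Y → Bool) → Bool :=
  Sum.elim (fun g ↦ g xy.1) fun g ↦ g xy.2

lemma path_ask (xy : X × Y) (l : List ((X → Bool) ⊕ (Y → Bool)))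
    (k : List Bool → ProtocolTree X Y) :
    (ask l k).path xy = l.map (answer xy) ++ (k (l.map (answer xy))).path xy := by
  induction l generalizing k with
  | nil => rfl
  | cons q l ih =>
    rcases q with g | g <;> simp [ask, path, ih, answer]

variable [Fintype X] [Fintype Y]

/-- Questions that together reveal both inputs. -/
lemma exists_questions : ∃ l : List ((X → Bool) ⊕ (Y → Bool)),
    Function.Injective fun xy : X × Y ↦ l.map (answer xy) := by
  classical
  refine ⟨Finset.univ.toList.map (fun x' ↦ .inl fun x ↦ decide (x = x')) ++
    Finset.univ.toList.map (fun y' ↦ .inr fun y ↦ decide (y = y')), ?_⟩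
  rintro ⟨x, y⟩ ⟨x', y'⟩ h
  simp only [List.map_append, List.map_map] at h
  obtain ⟨h1, h2⟩ := List.append_inj h (by simp)
  have h1' := List.map_inj_left.1 h1 x (by simp)
  have h2' := List.map_inj_left.1 h2 y (by simp)
  simp [answer] at h1' h2'
  rw [h1', h2']

/-- Ask first the questions in `l`, and then for both inputs, unless the answers are those on a
pair of inputs that satisfies `good`. -/
lemma exists_path_eq (l : List ((X → Bool) ⊕ (Y → Bool))) (good : X × Y → Prop) :
    ∃ t : ProtocolTree X Y,
      (∀ xy, good xy → t.path xy = l.map (answer xy)) ∧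
      ∀ xy xy', t.path xy = t.path xy' → xy = xy' ∨
        l.map (answer xy) = l.map (answer xy') ∧
        ∃ z, good z ∧ l.map (answer z) = l.map (answer xy) := by
  classical
  obtain ⟨l', hl'⟩ := exists_questions (X := X) (Y := Y)
  -- The decision to stop may use only the answers `s`, so it is also taken on inputs that merely
  -- share their answers with a good one. This is why the conclusion mentions a further input `z`.
  refine ⟨ask l fun s ↦ if ∃ z, good z ∧ l.map (answer z) = s then leaf
    else ask l' fun _ ↦ leaf, fun xy h ↦ ?_, fun xy xy' h ↦ ?_⟩
  · rw [path_ask, if_pos ⟨xy, h, rfl⟩]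
    simp [path]
  · rw [path_ask, path_ask] at h
    obtain ⟨h1, h2⟩ := List.append_inj h (by simp)
    by_cases hz : ∃ z, good z ∧ l.map (answer z) = l.map (answer xy)
    · exact .inr ⟨h1, hz⟩
    · rw [← h1, if_neg hz, path_ask, path_ask] at h2
      exact .inl (hl' (by simpa [path] using h2))

variable [MeasurableSpace X] [MeasurableSpace Y]

/-- Only an upper bound on the cost is needed, so finitely many transcripts suffice. -/
lemma sum_le_integral_dirac_prod_count {g : Unit × List Bool → ℝ}
    (hg : Integrable g ((Measure.dirac ()).prod Measure.count)) (h0 : ∀ x, 0 ≤ g x)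
    (W : Finset (List Bool)) :
    ∑ s ∈ W, g ((), s) ≤ ∫ x, g x ∂((Measure.dirac ()).prod Measure.count) := by
  have hga : Integrable (fun s ↦ g ((), s)) Measure.count := by
    have h := hg.prod_right_ae
    rwa [ae_dirac_eq] at h
  rw [integral_prod _ hg, integral_dirac]
  refine le_trans (le_of_eq ?_) (setIntegral_le_integral (s := (W : Set (List Bool))) hga
    (.of_forall fun s ↦ h0 _))
  rw [setIntegral_finset W hga.integrableOn]
  simp

open Classical in
-- All points of positive mass on the line share one path, and that single transcript already
-- carries the whole prior entropy of the line.
lemma massEntropy_le_sum_density (t : ProtocolTree X Y) (out : List Bool → Z)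
    {μ : Measure (X × Y)}
    (ht : ∀ a b : X × Y, 0 < μ.real {a} → 0 < μ.real {b} → (a.1 = b.1 ∨ a.2 = b.2) →
      t.path a = t.path b) {ι : Type*} [Fintype ι] (j : ι → X × Y)
    (hj : ∀ i i', (j i).1 = (j i').1 ∨ (j i).2 = (j i').2) :
    massEntropy (fun i ↦ μ.real {j i} * 1) ≤
      ∑ s ∈ Finset.univ.image fun xy : X × Y ↦ t.path xy,
        massEntropy fun i ↦ μ.real {j i} * (t.toProtocol out).density (j i) ((), s) := by
  simp only [density_toProtocol]
  have hnn : ∀ s, 0 ≤ massEntropy fun i ↦ μ.real {j i} * if t.path (j i) = s then 1 else 0 :=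
    fun s ↦ massEntropy_nonneg fun i ↦
      mul_nonneg measureReal_nonneg (by split_ifs <;> simp)
  by_cases h : ∃ i₀, 0 < μ.real {j i₀}
  · obtain ⟨i₀, hi₀⟩ := h
    refine le_trans (le_of_eq ?_) (Finset.single_le_sum (fun s _ ↦ hnn s)
      (Finset.mem_image_of_mem _ (Finset.mem_univ (j i₀))))
    congr 1
    funext i
    rcases (measureReal_nonneg (μ := μ) (s := {j i})).eq_or_lt with h0 | h0
    · rw [← h0, zero_mul, zero_mul]
    · rw [if_pos (ht _ _ h0 hi₀ (hj i i₀))]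
  · have h0 : ∀ i, μ.real {j i} = 0 := fun i ↦
      le_antisymm (not_lt.1 fun hi ↦ h ⟨i, hi⟩) measureReal_nonneg
    refine le_trans (le_of_eq ?_) (Finset.sum_nonneg fun s _ ↦ hnn s)
    simp [h0, massEntropy]

/-- If, on the support of `μ`, each player knows the transcript in advance, then the protocol
reveals nothing. -/
lemma infoCost_toProtocol_nonpos [DiscreteMeasurableSpace X] [DiscreteMeasurableSpace Y]
    (t : ProtocolTree X Y) (out : List Bool → Z) (μ : Measure (X × Y)) [IsProbabilityMeasure μ]
    (ht : ∀ a b : X × Y, 0 < μ.real {a} → 0 < μ.real {b} → (a.1 = b.1 ∨ a.2 = b.2) →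
      t.path a = t.path b) : (t.toProtocol out).infoCost μ ≤ 0 := by
  classical
  rw [Protocol.infoCost_eq]
  refine div_nonpos_of_nonpos_of_nonneg (sub_nonpos.2 ?_) (Real.log_nonneg one_le_two)
  refine le_trans ?_ (sum_le_integral_dirac_prod_count ((t.toProtocol out).integrable_residual μ)
    (fun s ↦ Protocol.residual_nonneg fun xy ↦ Protocol.density_nonneg _ _ _)
    (Finset.univ.image fun xy : X × Y ↦ t.path xy))
  simp only [Protocol.residual, Finset.sum_add_distrib]
  rw [Finset.sum_comm, Finset.sum_comm (t := (Finset.univ : Finset X))]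
  refine add_le_add (Finset.sum_le_sum fun y _ ↦ ?_) (Finset.sum_le_sum fun x _ ↦ ?_)
  · exact massEntropy_le_sum_density t out ht (fun x ↦ (x, y)) fun _ _ ↦ .inr rfl
  · exact massEntropy_le_sum_density t out ht (fun y ↦ (x, y)) fun _ _ ↦ .inl rfl

end ProtocolTree

/-! ### The range of admissible errors -/

section Threshold

/-- The range of errors for which the trade-off is proved: `n` is the number of inputs, `m` bounds
the relevant masses from below, and `q` the exclusion probability. -/
noncomputable def threshold (n : ℕ) (m q : ℝ) : ℝ :=
  Real.exp (-(4 * n / (m * q) + 1 + 2 * Real.log (2 / m)))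

lemma threshold_pos (n : ℕ) (m q : ℝ) : 0 < threshold n m q := Real.exp_pos _

variable {n : ℕ} {m q ε : ℝ}

lemma threshold_lt_one (hm : 0 < m) (hm1 : m ≤ 1) (hq : 0 < q) : threshold n m q < 1 := by
  have h1 : 0 ≤ Real.log (2 / m) := Real.log_nonneg ((one_le_div hm).2 (by linarith))
  have h2 : 0 ≤ 4 * n / (m * q) := by positivity
  exact (Real.exp_lt_exp.2 (by linarith)).trans_eq Real.exp_zero

lemma binEntropy_le_mul_log (hε1 : ε < 1) :
    Real.binEntropy ε ≤ ε * (Real.log ε⁻¹ + 1) := by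
  have h1 : 0 < 1 - ε := by linarith
  have h2 := Real.log_le_sub_one_of_pos (inv_pos.2 h1)
  have h3 : (1 - ε) * Real.log (1 - ε)⁻¹ ≤ ε := by
    calc _ ≤ (1 - ε) * ((1 - ε)⁻¹ - 1) := mul_le_mul_of_nonneg_left h2 h1.le
      _ = ε := by rw [mul_sub, mul_inv_cancel₀ h1.ne']; ring
  rw [Real.binEntropy]
  linarith

/-- With `L = log (1/ε)` and `M = log (2/m)`, the gain is at least `ε β q (L - M)` and the entropy
at most `ε (L + 1)`. The claim thus reduces to `4 n / (β q) ≤ L - 1 - 2 M`, which is what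
`threshold` encodes. -/
lemma loss_sub_gain_le {α β x : ℝ} (hm : 0 < m) (hα : m ≤ α) (hβ : m ≤ β) (hm1 : m ≤ 1)
    (hq : 0 < q) (hqx : q ≤ x) (hε0 : 0 < ε) (hε : ε ≤ threshold n m q) :
    2 * n * ε - ε * β * Real.log (α / (2 * ε)) * x ≤ -(β * q / 2 * Real.binEntropy ε) := by
  have hβ0 := hm.trans_le hβ
  set L := Real.log ε⁻¹ with hL
  set M := Real.log (2 / m) with hM
  have hM0 : 0 ≤ M := Real.log_nonneg ((one_le_div hm).2 (by linarith))
  have hLge : 4 * n / (m * q) + 1 + 2 * M ≤ L := by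
    rw [hL, Real.log_inv, le_neg]
    exact (Real.log_le_iff_le_exp hε0).2 hε
  have hlog : L - M ≤ Real.log (α / (2 * ε)) := by
    rw [hL, hM, ← Real.log_div (by positivity) (by positivity)]
    refine Real.log_le_log (by positivity) ?_
    rw [show ε⁻¹ / (2 / m) = m / (2 * ε) by field_simp]
    gcongr
  have hn0 : 0 ≤ 4 * n / (m * q) := by positivity
  have hbin := binEntropy_le_mul_log (hε.trans_lt (threshold_lt_one hm hm1 hq))
  have h4 : 4 * n / (β * q) ≤ L - 1 - 2 * M := by
    have : 4 * n / (β * q) ≤ 4 * n / (m * q) := by gcongr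
    linarith
  rw [div_le_iff₀ (by positivity)] at h4
  have h5 : (L - M) * q ≤ Real.log (α / (2 * ε)) * x :=
    mul_le_mul hlog hqx hq.le (by linarith)
  have h6 : ε * β * ((L - M) * q) ≤ ε * β * (Real.log (α / (2 * ε)) * x) :=
    mul_le_mul_of_nonneg_left h5 (by positivity)
  have h7 : β * q / 2 * Real.binEntropy ε ≤ β * q / 2 * (ε * (L + 1)) :=
    mul_le_mul_of_nonneg_left hbin (by positivity)
  have h8 := mul_le_mul_of_nonneg_left h4 hε0.le
  nlinarith

end Threshold

/-! ### Exclusion probabilities of zero-error protocols -/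

namespace Protocol

variable {X : Type u} {Y : Type v} {Z : Type w} (π : Protocol X Y Z)

section Exclusion

lemma exclusion_eq_integral (a b : X × Y) (δ : ℝ) :
    π.exclusion a b δ = ∫ t, {t | π.density b t ≤ δ * π.density a t}.indicator (π.density a) t
      ∂π.transcriptMeasure :=
  (integral_indicator (π.measurableSet_density_le a b δ)).symm

lemma integrable_exclusion (a b : X × Y) (δ : ℝ) :
    Integrable ({t | π.density b t ≤ δ * π.density a t}.indicator (π.density a))
      π.transcriptMeasure :=
  (π.integrable_density a).indicator (π.measurableSet_density_le a b δ)

lemma exclusion_eq_one {a b : X × Y} {δ : ℝ} (hδ : 0 ≤ δ)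
    (h : ∀ᵐ t ∂π.transcriptMeasure, 0 < π.density a t → 0 < π.density b t → False) :
    π.exclusion a b δ = 1 := by
  rw [exclusion_eq_integral, ← π.integral_density a]
  refine integral_congr_ae ?_
  filter_upwards [h] with t ht
  refine Set.indicator_apply_eq_self.2 fun hn ↦ ?_
  by_contra hne
  have ha := (π.density_nonneg a t).lt_of_ne (Ne.symm hne)
  exact ht ha ((mul_nonneg hδ ha.le).trans_lt (not_le.1 hn))

lemma exclusion_self (a : X × Y) {δ : ℝ} (hδ : δ < 1) : π.exclusion a a δ = 0 := by
  rw [exclusion_eq_integral]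
  refine integral_eq_zero_of_ae (.of_forall fun t ↦ ?_)
  refine Set.indicator_apply_eq_zero.2 fun ht ↦ ?_
  have h0 := π.density_nonneg a t
  have ht' : π.density a t ≤ δ * π.density a t := ht
  nlinarith

/-- If `c` is nearly excluded relative to `a`, then either `b` is too, or the density of `b` exceeds
`δ` times that of `a`. In the latter case `c` is nearly excluded relative to `b`, and changing the
measure from `a` to `b` costs the factor `δ⁻¹`. -/
lemma exclusion_trans_le (a b c : X × Y) {δ δ' : ℝ} (hδ : 0 < δ) (hδ' : 0 ≤ δ') :
    π.exclusion a c (δ' * δ) ≤ π.exclusion a b δ + δ⁻¹ * π.exclusion b c δ' := by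
  rw [exclusion_eq_integral, exclusion_eq_integral, exclusion_eq_integral, ← integral_const_mul,
    ← integral_add (π.integrable_exclusion _ _ _) ((π.integrable_exclusion _ _ _).const_mul _)]
  refine integral_mono (π.integrable_exclusion _ _ _)
    ((π.integrable_exclusion _ _ _).add ((π.integrable_exclusion _ _ _).const_mul _)) fun t ↦ ?_
  have ha := π.density_nonneg a t
  have hb := π.density_nonneg b t
  have hA : 0 ≤ {t | π.density b t ≤ δ * π.density a t}.indicator (π.density a) t :=
    Set.indicator_nonneg (fun t _ ↦ π.density_nonneg a t) t
  have hB : 0 ≤ δ⁻¹ * {t | π.density c t ≤ δ' * π.density b t}.indicator (π.density b) t :=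
    mul_nonneg (inv_nonneg.2 hδ.le) (Set.indicator_nonneg (fun t _ ↦ π.density_nonneg b t) t)
  by_cases hac : π.density c t ≤ δ' * δ * π.density a t
  · rw [Set.indicator_of_mem (show t ∈ {t | π.density c t ≤ δ' * δ * π.density a t} from hac)]
    by_cases hab : π.density b t ≤ δ * π.density a t
    · rw [Set.indicator_of_mem (show t ∈ {t | π.density b t ≤ δ * π.density a t} from hab)]
      exact le_add_of_nonneg_right hB
    · have hbc : π.density c t ≤ δ' * π.density b t := by
        rw [mul_assoc] at hac
        exact hac.trans (mul_le_mul_of_nonneg_left (not_le.1 hab).le hδ')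
      rw [Set.indicator_of_mem (show t ∈ {t | π.density c t ≤ δ' * π.density b t} from hbc)]
      refine le_add_of_nonneg_of_le hA ?_
      rw [inv_mul_eq_div, le_div_iff₀ hδ, mul_comm]
      exact (not_le.1 hab).le
  · rw [Set.indicator_of_notMem (show t ∉ {t | π.density c t ≤ δ' * δ * π.density a t} from hac)]
    exact add_nonneg hA hB

variable {π} {f : X × Y → Z}

/-- A transcript possible on `a` and `b` is possible on `(a.1, b.2)` as well, and its single output
would be correct for all three. -/
lemma exclusion_eq_one_of_ne (hπ : π.Performs f 0) {a b : X × Y} {δ : ℝ} (hδ : 0 ≤ δ)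
    (h : f a ≠ f (a.1, b.2) ∨ f b ≠ f (a.1, b.2)) : π.exclusion a b δ = 1 := by
  refine π.exclusion_eq_one hδ ?_
  filter_upwards [π.density_eq_zero_of_performs hπ a, π.density_eq_zero_of_performs hπ b,
    π.density_eq_zero_of_performs hπ (a.1, b.2)] with t h1 h2 h3 ha hb
  have hc : 0 < π.density (a.1, b.2) t := π.density_cross_pos (by exact ha) (by exact hb)
  have e1 := not_imp_comm.1 h1 ha.ne'
  have e2 := not_imp_comm.1 h2 hb.ne'
  have e3 := not_imp_comm.1 h3 hc.ne'
  rcases h with h | h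
  · exact h (e1.symm.trans e3)
  · exact h (e2.symm.trans e3)

/-- A transcript possible on both neighbours of `(x₀, y₀)` is possible on `(x₀, y₀)` and `(x₁, y₁)`,
where the correct outputs differ. So almost every transcript has likelihood zero on some neighbour.
-/
lemma one_le_exclusion_add (hπ : π.Performs f 0) {x₀ x₁ : X} {y₀ y₁ : Y}
    (h : f (x₁, y₁) ≠ f (x₀, y₀)) :
    1 ≤ π.exclusion (x₀, y₀) (x₁, y₀) 0 + π.exclusion (x₀, y₀) (x₀, y₁) 0 := by
  rw [exclusion_eq_integral, exclusion_eq_integral, ← π.integral_density (x₀, y₀),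
    ← integral_add (π.integrable_exclusion _ _ _) (π.integrable_exclusion _ _ _)]
  refine integral_mono_ae (π.integrable_density _)
    ((π.integrable_exclusion _ _ _).add (π.integrable_exclusion _ _ _)) ?_
  filter_upwards [π.density_eq_zero_of_performs hπ (x₀, y₀),
    π.density_eq_zero_of_performs hπ (x₁, y₁)] with t h1 h2
  have h0 := π.density_nonneg (x₀, y₀) t
  have hA : ∀ b, 0 ≤ {t | π.density b t ≤ 0 * π.density (x₀, y₀) t}.indicator
      (π.density (x₀, y₀)) t := fun b ↦
    Set.indicator_nonneg (fun t _ ↦ π.density_nonneg _ t) t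
  by_cases hb : π.density (x₁, y₀) t ≤ 0 * π.density (x₀, y₀) t
  · refine le_add_of_le_of_nonneg (le_of_eq ?_) (hA _)
    exact (Set.indicator_of_mem
      (show t ∈ {t | π.density (x₁, y₀) t ≤ 0 * π.density (x₀, y₀) t} from hb) _).symm
  by_cases hc : π.density (x₀, y₁) t ≤ 0 * π.density (x₀, y₀) t
  · refine le_add_of_nonneg_of_le (hA _) (le_of_eq ?_)
    exact (Set.indicator_of_mem
      (show t ∈ {t | π.density (x₀, y₁) t ≤ 0 * π.density (x₀, y₀) t} from hc) _).symm
  rw [zero_mul, not_le] at hb hc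
  have hd := π.density_cross_pos hb hc
  have e2 := not_imp_comm.1 h2 hd.ne'
  have h3 : 0 < π.density (x₀, y₀) t := π.density_cross_pos hc hb
  exact absurd (e2.symm.trans (not_imp_comm.1 h1 h3.ne')) h

end Exclusion

/-! ### The trade-off for one protocol and for the infimum -/

section TradeOff

variable [Fintype X] [Fintype Y] [MeasurableSpace X] [MeasurableSpace Y]
  [DiscreteMeasurableSpace X] [DiscreteMeasurableSpace Y]
  {μ : Measure (X × Y)} [IsProbabilityMeasure μ] {f : X × Y → Z} {π}

lemma exists_performs_infoCost_le_sub (hπ : π.Performs f 0) {a b : X × Y}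
    (hab : a.1 = b.1 ∨ a.2 = b.2) {m q ε : ℝ} (hm : 0 < m) (hma : m ≤ μ.real {a})
    (hmb : m ≤ μ.real {b}) (hq : 0 < q) (hε0 : 0 ≤ ε)
    (hε : ε ≤ threshold (Fintype.card (X × Y)) m q) (hx : q ≤ π.exclusion a b ε) :
    ∃ π' : Protocol X Y Z, π'.Performs f ε ∧
      π'.infoCost μ ≤ π.infoCost μ - μ.real {b} * q / 2 * h ε := by
  rcases hε0.eq_or_lt with rfl | hε0
  -- At `ε = 0` the logarithmic estimate is meaningless, but `h 0 = 0` and nothing has to be gained.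
  · exact ⟨π, hπ, by simp [h]⟩
  have hm1 : m ≤ 1 := hma.trans measureReal_le_one
  obtain ⟨π', h1, h2⟩ := π.exists_performs_infoCost_le μ hπ hab (hm.trans_le hma)
    (hm.trans_le hmb) hε0 (hε.trans (threshold_lt_one hm hm1 hq).le)
  refine ⟨π', h1, h2.trans ?_⟩
  have h3 := loss_sub_gain_le hm hma hmb hm1 hq hx hε0 hε
  rw [h, ← mul_div_assoc, sub_eq_add_neg (π.infoCost μ), ← neg_div]
  gcongr

end TradeOff

end Protocol

section IC

variable {X : Type u} {Y : Type v} {Z : Type w} [Fintype X] [Fintype Y] [MeasurableSpace X]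
  [MeasurableSpace Y] [DiscreteMeasurableSpace X] [DiscreteMeasurableSpace Y]
  {μ : Measure (X × Y)} [IsProbabilityMeasure μ] {f : X × Y → Z}

lemma IC_le {π : Protocol X Y Z} {ε : ℝ} (hπ : π.Performs f ε) : IC μ f ε ≤ π.infoCost μ :=
  ciInf_le (f := fun π : {π : Protocol X Y Z // π.Performs f ε} ↦ π.1.infoCost μ)
    ⟨_, by rintro _ ⟨π, rfl⟩; exact π.1.infoCost_ge μ⟩ ⟨π, hπ⟩

omit [DiscreteMeasurableSpace X] [DiscreteMeasurableSpace Y] [IsProbabilityMeasure μ] in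
-- A real infimum over an empty family is 0 by convention, so positivity also provides a protocol.
lemma nonempty_of_IC_pos {ε : ℝ} (hIC : 0 < IC μ f ε) :
    Nonempty {π : Protocol X Y Z // π.Performs f ε} := by
  by_contra hn
  rw [not_nonempty_iff] at hn
  rw [IC, Real.iInf_of_isEmpty] at hIC
  exact hIC.false

omit [DiscreteMeasurableSpace X] [DiscreteMeasurableSpace Y] [IsProbabilityMeasure μ] in
lemma exists_infoCost_lt {ε κ : ℝ} (hIC : 0 < IC μ f ε) (hκ : 0 < κ) :
    ∃ π : Protocol X Y Z, π.Performs f ε ∧ π.infoCost μ < IC μ f ε + κ := by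
  have := nonempty_of_IC_pos hIC
  obtain ⟨⟨π, hπ⟩, h⟩ := exists_lt_of_ciInf_lt (show IC μ f ε < IC μ f ε + κ by linarith)
  exact ⟨π, hπ, h⟩

/-- The infimum need not be attained; the gain `g` must therefore be the same for all `κ`, while the
protocols may vary. -/
lemma IC_le_IC_sub {ε g : ℝ}
    (hg : ∀ κ : ℝ, 0 < κ → ∃ π π' : Protocol X Y Z, π.infoCost μ < IC μ f 0 + κ ∧
      π'.Performs f ε ∧ π'.infoCost μ ≤ π.infoCost μ - g) :
    IC μ f ε ≤ IC μ f 0 - g := by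
  refine le_of_forall_pos_le_add fun κ hκ ↦ ?_
  obtain ⟨π, π', h1, h2, h3⟩ := hg κ hκ
  have := IC_le (μ := μ) h2
  linarith

/-- Among the nearly optimal zero-error protocols, the probability on the input `a` that the
transcript nearly excludes `b` is arbitrarily small. -/
def RarelyExcludes (μ : Measure (X × Y)) (f : X × Y → Z) (a b : X × Y) : Prop :=
  ∀ q : ℝ, 0 < q → ∃ δ : ℝ, 0 < δ ∧ ∃ κ : ℝ, 0 < κ ∧ ∀ π : Protocol X Y Z, π.Performs f 0 →
    π.infoCost μ < IC μ f 0 + κ → π.exclusion a b δ < q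

omit [DiscreteMeasurableSpace X] [DiscreteMeasurableSpace Y] [IsProbabilityMeasure μ]

lemma RarelyExcludes.refl (a : X × Y) : RarelyExcludes μ f a a := fun q hq ↦
  ⟨1 / 2, by norm_num, 1, one_pos, fun π _ _ ↦ by
    rw [π.exclusion_self a (by norm_num)]; exact hq⟩

lemma RarelyExcludes.trans {a b c : X × Y} (hab : RarelyExcludes μ f a b)
    (hbc : RarelyExcludes μ f b c) : RarelyExcludes μ f a c := by
  intro q hq
  obtain ⟨δ, hδ, κ, hκ, h⟩ := hab (q / 2) (half_pos hq)
  -- The extra factor `δ` absorbs the `δ⁻¹` of `exclusion_trans_le`.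
  obtain ⟨δ', hδ', κ', hκ', h'⟩ := hbc (δ * (q / 2)) (by positivity)
  refine ⟨δ' * δ, by positivity, min κ κ', lt_min hκ hκ', fun π hπ hcost ↦ ?_⟩
  have h1 := h π hπ (hcost.trans_le (by gcongr; exact min_le_left _ _))
  have h2 := h' π hπ (hcost.trans_le (by gcongr; exact min_le_right _ _))
  have h3 : δ⁻¹ * π.exclusion b c δ' < q / 2 := by
    rwa [inv_mul_lt_iff₀ hδ]
  linarith [π.exclusion_trans_le a b c hδ hδ'.le]

lemma RarelyExcludes.apply_eq {a b : X × Y} (hIC : 0 < IC μ f 0)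
    (hab : RarelyExcludes μ f a b) : f a = f (a.1, b.2) ∧ f b = f (a.1, b.2) := by
  obtain ⟨δ, hδ, κ, hκ, h⟩ := hab 1 one_pos
  obtain ⟨π, hπ, hcost⟩ := exists_infoCost_lt hIC hκ
  by_contra hne
  rw [not_and_or] at hne
  exact (h π hπ hcost).ne (Protocol.exclusion_eq_one_of_ne hπ hδ.le hne)

/-- Two inputs of positive mass in the same row or column. -/
def Linked (μ : Measure (X × Y)) (a b : X × Y) : Prop :=
  0 < μ.real {a} ∧ 0 < μ.real {b} ∧ (a.1 = b.1 ∨ a.2 = b.2)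

omit [Fintype X] [Fintype Y] in
lemma Linked.symm {a b : X × Y} (h : Linked μ a b) : Linked μ b a :=
  ⟨h.2.1, h.1, h.2.2.imp Eq.symm Eq.symm⟩

lemma RarelyExcludes.of_reflTransGen
    (hlink : ∀ a b : X × Y, Linked μ a b → RarelyExcludes μ f a b) {a b : X × Y}
    (h : Relation.ReflTransGen (Linked μ) a b) : RarelyExcludes μ f a b := by
  induction h with
  | refl => exact .refl _
  | tail _ h ih => exact ih.trans (hlink _ _ h)

variable [DiscreteMeasurableSpace X] [DiscreteMeasurableSpace Y] [IsProbabilityMeasure μ]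

/-- Unless the information complexity vanishes, one input in the support excludes another one in
its row or column with a probability that is bounded away from zero. -/
lemma exists_not_rarelyExcludes (hIC : 0 < IC μ f 0) :
    ∃ a b : X × Y, Linked μ a b ∧ ¬ RarelyExcludes μ f a b := by
  classical
  by_contra! hlink
  have hreach : ∀ {a b : X × Y}, Relation.ReflTransGen (Linked μ) a b →
      f a = f (a.1, b.2) ∧ f b = f (a.1, b.2) := fun h ↦
    (RarelyExcludes.of_reflTransGen hlink h).apply_eq hIC
  have hsymm : ∀ {a b : X × Y}, Relation.ReflTransGen (Linked μ) a b →
      Relation.ReflTransGen (Linked μ) b a := fun h ↦ by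
    have : Std.Symm (Linked μ) := ⟨fun _ _ h ↦ h.symm⟩
    exact Std.Symm.symm _ _ h
  -- The rows, and below the columns, met by the component of `c`; `good` holds on the union of the
  -- rectangles that they span.
  let inRow (c : X × Y) (x : X) : Prop :=
    ∃ e : X × Y, e.1 = x ∧ 0 < μ.real {e} ∧ Relation.ReflTransGen (Linked μ) c e
  let inCol (c : X × Y) (y : Y) : Prop :=
    ∃ e : X × Y, e.2 = y ∧ 0 < μ.real {e} ∧ Relation.ReflTransGen (Linked μ) c e
  let good (xy : X × Y) : Prop := ∃ c, inRow c xy.1 ∧ inCol c xy.2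
  let l : List ((X → Bool) ⊕ (Y → Bool)) :=
    Finset.univ.toList.map (fun c ↦ .inl fun x ↦ decide (inRow c x)) ++
      Finset.univ.toList.map (fun c ↦ .inr fun y ↦ decide (inCol c y))
  have hl : ∀ xy xy' : X × Y,
      l.map (ProtocolTree.answer xy) = l.map (ProtocolTree.answer xy') ↔
        ∀ c, (inRow c xy.1 ↔ inRow c xy'.1) ∧ (inCol c xy.2 ↔ inCol c xy'.2) := by
    intro xy xy'
    rw [List.map_inj_left]
    simp only [l, List.forall_mem_append, List.forall_mem_map, ProtocolTree.answer, Sum.elim_inl,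
      Sum.elim_inr, Finset.mem_toList, Finset.mem_univ, forall_const, decide_eq_decide,
      forall_and]
  -- The point is the corner of two points `e`, `e'` of the component, and `hreach` compares its
  -- value with that of `e`, then with that of `c`.
  have hgood : ∀ {c xy}, inRow c xy.1 → inCol c xy.2 → f xy = f c := by
    rintro c ⟨x, y⟩ ⟨e, rfl, -, he⟩ ⟨e', rfl, -, he'⟩
    have h1 := hreach ((hsymm he).trans he')
    have h2 := hreach he
    exact h1.1.symm.trans (h2.2.trans h2.1.symm)
  have hrow : ∀ c (a : X × Y), 0 < μ.real {a} →
      (inRow c a.1 ↔ Relation.ReflTransGen (Linked μ) c a) := fun c a ha ↦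
    ⟨fun ⟨e, h1, h2, h3⟩ ↦ h3.tail ⟨h2, ha, .inl h1⟩, fun h ↦ ⟨a, rfl, ha, h⟩⟩
  have hcol : ∀ c (a : X × Y), 0 < μ.real {a} →
      (inCol c a.2 ↔ Relation.ReflTransGen (Linked μ) c a) := fun c a ha ↦
    ⟨fun ⟨e, h1, h2, h3⟩ ↦ h3.tail ⟨h2, ha, .inr h1⟩, fun h ↦ ⟨a, rfl, ha, h⟩⟩
  have hsupp : ∀ a : X × Y, 0 < μ.real {a} → good a := fun a ha ↦
    ⟨a, (hrow a a ha).2 .refl, (hcol a a ha).2 .refl⟩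
  obtain ⟨t, ht1, ht2⟩ := ProtocolTree.exists_path_eq l good
  have hfac : f.FactorsThrough fun xy ↦ t.path xy := by
    intro xy xy' h
    rcases ht2 xy xy' h with rfl | ⟨h1, z, ⟨c, hc1, hc2⟩, h2⟩
    · rfl
    · have h3 := (hl _ _).1 h2 c
      have h4 := (hl _ _).1 h1 c
      rw [hgood (h3.1.1 hc1) (h3.2.1 hc2),
        hgood (h4.1.1 (h3.1.1 hc1)) (h4.2.1 (h3.2.1 hc2))]
  -- An existing protocol supplies some element of `Z` as the output on strings that are not paths.
  obtain ⟨⟨π₀, -⟩⟩ := nonempty_of_IC_pos hIC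
  obtain ⟨r⟩ := nonempty_of_isProbabilityMeasure π₀.pubLaw
  set out : List Bool → Z := Function.extend (fun xy ↦ t.path xy) f fun s ↦ π₀.output r s
  have hperf : (t.toProtocol out).Performs f 0 := by
    intro xy
    have : {ρ | (t.toProtocol out).result xy ρ ≠ f xy} = ∅ := by
      refine Set.eq_empty_of_forall_notMem fun ρ hρ ↦ hρ ?_
      rw [Protocol.result, ProtocolTree.bits_toProtocol]
      exact hfac.extend_apply _ xy
    rw [this, measureReal_empty]
  have hcost : (t.toProtocol out).infoCost μ ≤ 0 := by
    refine t.infoCost_toProtocol_nonpos out μ fun a b ha hb hab ↦ ?_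
    rw [ht1 a (hsupp a ha), ht1 b (hsupp b hb), hl]
    -- Two support points on a line lie in the same component, so all their answers agree.
    have hiff : ∀ c, Relation.ReflTransGen (Linked μ) c a ↔
        Relation.ReflTransGen (Linked μ) c b := fun c ↦
      ⟨fun h ↦ h.tail ⟨ha, hb, hab⟩, fun h ↦ h.tail (Linked.symm ⟨ha, hb, hab⟩)⟩
    exact fun c ↦ ⟨by rw [hrow c a ha, hrow c b hb, hiff], by rw [hcol c a ha, hcol c b hb, hiff]⟩
  exact absurd (IC_le (μ := μ) hperf) (not_le.2 (hcost.trans_lt hIC))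

lemma exists_IC_le_sub (hIC : 0 < IC μ f 0) :
    ∃ τ : ℝ, 0 < τ ∧ ∃ ε₀ : ℝ, 0 < ε₀ ∧ ∀ ε : ℝ, 0 ≤ ε → ε ≤ ε₀ →
      IC μ f ε ≤ IC μ f 0 - τ * h ε := by
  obtain ⟨a, b, ⟨ha, hb, hab⟩, hne⟩ := exists_not_rarelyExcludes hIC
  simp only [RarelyExcludes, not_forall, not_exists, not_and, not_lt] at hne
  obtain ⟨q, hq, hne⟩ := hne
  refine ⟨μ.real {b} * q / 2, by positivity,
    threshold (Fintype.card (X × Y)) (min (μ.real {a}) (μ.real {b})) q, threshold_pos _ _ _,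
    fun ε hε0 hε ↦ ?_⟩
  rcases hε0.eq_or_lt with rfl | hε0
  · simp [h]
  refine IC_le_IC_sub fun κ hκ ↦ ?_
  -- The bound `q` was fixed before `ε` and `κ`; the exclusion level `δ` is taken to be `ε` itself.
  obtain ⟨π, hπ, hcost, hx⟩ := hne ε hε0 κ hκ
  obtain ⟨π', h1, h2⟩ := Protocol.exists_performs_infoCost_le_sub (μ := μ) hπ hab
    (lt_min ha hb) (min_le_left _ _) (min_le_right _ _) hq hε0.le hε hx
  exact ⟨π, π', hcost, h1, h2⟩

lemma h_nonneg {ε : ℝ} (hε0 : 0 ≤ ε) (hε1 : ε ≤ 1) : 0 ≤ h ε :=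
  div_nonneg (Real.binEntropy_nonneg hε0 hε1) (Real.log_nonneg one_le_two)

lemma IC_le_sub_of_ne (hIC : 0 < IC μ f 0) {a b : X × Y} (ha : 0 < μ.real {a})
    (hb : 0 < μ.real {b}) (hab : a.1 = b.1 ∨ a.2 = b.2) (hf : f a ≠ f b) {ε : ℝ} (hε0 : 0 ≤ ε)
    (hε : ε ≤ threshold (Fintype.card (X × Y)) (min (μ.real {a}) (μ.real {b})) 1) :
    IC μ f ε ≤ IC μ f 0 - μ.real {b} / 2 * h ε := by
  refine IC_le_IC_sub fun κ hκ ↦ ?_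
  obtain ⟨π, hπ, hcost⟩ := exists_infoCost_lt hIC hκ
  have hne : f a ≠ f (a.1, b.2) ∨ f b ≠ f (a.1, b.2) := by
    by_contra! h
    exact hf (h.1.trans h.2.symm)
  obtain ⟨π', h1, h2⟩ := Protocol.exists_performs_infoCost_le_sub (μ := μ) hπ hab
    (lt_min ha hb) (min_le_left _ _) (min_le_right _ _) one_pos hε0 hε
    (Protocol.exclusion_eq_one_of_ne hπ hε0 hne).ge
  rw [mul_one] at h2
  exact ⟨π, π', hcost, h1, h2⟩

lemma IC_le_sub_of_and (hIC : 0 < IC μ f 0) {x₀ x₁ : X} {y₀ y₁ : Y}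
    (hf : f (x₁, y₁) ≠ f (x₀, y₀)) (h00 : 0 < μ.real {(x₀, y₀)}) (h01 : 0 < μ.real {(x₀, y₁)})
    (h10 : 0 < μ.real {(x₁, y₀)}) {ε : ℝ} (hε0 : 0 ≤ ε)
    (hε : ε ≤ threshold (Fintype.card (X × Y))
      (min (μ.real {(x₀, y₀)}) (min (μ.real {(x₀, y₁)}) (μ.real {(x₁, y₀)}))) (1 / 2)) :
    IC μ f ε ≤ IC μ f 0 - min (μ.real {(x₀, y₁)}) (μ.real {(x₁, y₀)}) / 4 * h ε := by
  refine IC_le_IC_sub fun κ hκ ↦ ?_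
  obtain ⟨π, hπ, hcost⟩ := exists_infoCost_lt hIC hκ
  have hm : 0 < min (μ.real {(x₀, y₀)}) (min (μ.real {(x₀, y₁)}) (μ.real {(x₁, y₀)})) :=
    lt_min h00 (lt_min h01 h10)
  have hh : 0 ≤ h ε := h_nonneg hε0 (hε.trans (threshold_lt_one hm
    ((min_le_left _ _).trans measureReal_le_one) (by norm_num)).le)
  -- Which neighbour is excluded with probability at least 1/2 may depend on `π`, hence on `κ`; the
  -- minimum of the two masses makes the gain independent of that choice.
  have key : ∀ b : X × Y, ((x₀, y₀) : X × Y).1 = b.1 ∨ ((x₀, y₀) : X × Y).2 = b.2 →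
      min (μ.real {(x₀, y₁)}) (μ.real {(x₁, y₀)}) ≤ μ.real {b} →
      1 / 2 ≤ π.exclusion (x₀, y₀) b 0 →
      ∃ π π' : Protocol X Y Z, π.infoCost μ < IC μ f 0 + κ ∧ π'.Performs f ε ∧
        π'.infoCost μ ≤ π.infoCost μ -
          min (μ.real {(x₀, y₁)}) (μ.real {(x₁, y₀)}) / 4 * h ε := by
    intro b hb hmb hx
    obtain ⟨π', h1, h2⟩ := Protocol.exists_performs_infoCost_le_sub (μ := μ) hπ hb
      hm (min_le_left _ _) ((min_le_right _ _).trans hmb) one_half_pos hε0 hε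
      (hx.trans (π.exclusion_mono _ _ hε0))
    refine ⟨π, π', hcost, h1, h2.trans (sub_le_sub_left (mul_le_mul_of_nonneg_right ?_ hh) _)⟩
    linarith
  have hsum := Protocol.one_le_exclusion_add hπ hf
  rcases le_or_gt (1 / 2) (π.exclusion (x₀, y₀) (x₁, y₀) 0) with hx | hx
  · exact key (x₁, y₀) (.inr rfl) (min_le_right _ _) hx
  · exact key (x₀, y₁) (.inl rfl) (min_le_left _ _) (by linarith)

end IC

end CommInfo

theorem mainTheorem1 :
    -- every `f` and `μ` with positive zero-error information complexity
    (∀ (X : Type u) (Y : Type v) (Z : Type w) [Fintype X] [Fintype Y]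
      [MeasurableSpace X] [DiscreteMeasurableSpace X]
      [MeasurableSpace Y] [DiscreteMeasurableSpace Y]
      (f : X × Y → Z) (μ : Measure (X × Y)) [IsProbabilityMeasure μ],
      0 < CommInfo.IC μ f 0 →
      ∃ τ : ℝ, 0 < τ ∧ ∃ ε₀ : ℝ, 0 < ε₀ ∧ ∀ ε : ℝ, 0 ≤ ε → ε ≤ ε₀ →
        CommInfo.IC μ f ε ≤ CommInfo.IC μ f 0 - τ * CommInfo.h ε) ∧
    -- the non-constant case
    (∃ ε₀ : ℕ → ℝ → ℝ, (∀ n m, 0 < m → 0 < ε₀ n m) ∧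
      ∀ (X : Type u) (Y : Type v) (Z : Type w) [Fintype X] [Fintype Y]
        [MeasurableSpace X] [DiscreteMeasurableSpace X]
        [MeasurableSpace Y] [DiscreteMeasurableSpace Y]
        (f : X × Y → Z) (μ : Measure (X × Y)) [IsProbabilityMeasure μ],
        0 < CommInfo.IC μ f 0 →
        ∀ a b : X × Y, 0 < μ.real {a} → 0 < μ.real {b} → (a.1 = b.1 ∨ a.2 = b.2) →
          f a ≠ f b →
        ∃ τ : ℝ, μ.real {a} ^ 2 * μ.real {b} / 64 ≤ τ ∧
          ∀ ε : ℝ, 0 ≤ ε →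
            ε ≤ ε₀ (Fintype.card (X × Y)) (min (μ.real {a}) (μ.real {b})) →
            CommInfo.IC μ f ε ≤ CommInfo.IC μ f 0 - τ * CommInfo.h ε) ∧
    -- the AND case
    (∃ ε₀ : ℕ → ℝ → ℝ, (∀ n m, 0 < m → 0 < ε₀ n m) ∧
      ∀ (X : Type u) (Y : Type v) (Z : Type w) [Fintype X] [Fintype Y]
        [MeasurableSpace X] [DiscreteMeasurableSpace X]
        [MeasurableSpace Y] [DiscreteMeasurableSpace Y]
        (f : X × Y → Z) (μ : Measure (X × Y)) [IsProbabilityMeasure μ],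
        0 < CommInfo.IC μ f 0 →
        ∀ (x₀ x₁ : X) (y₀ y₁ : Y) (z₀ z₁ : Z),
          f (x₀, y₀) = z₀ → f (x₀, y₁) = z₀ → f (x₁, y₀) = z₀ → f (x₁, y₁) = z₁ → z₁ ≠ z₀ →
          0 < μ.real {(x₀, y₀)} → 0 < μ.real {(x₀, y₁)} → 0 < μ.real {(x₁, y₀)} →
        ∃ τ : ℝ,
          μ.real {(x₀, y₀)} ^ 2 / 128 * min (μ.real {(x₀, y₁)}) (μ.real {(x₁, y₀)}) ≤ τ ∧
          ∀ ε : ℝ, 0 ≤ ε →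
            ε ≤ ε₀ (Fintype.card (X × Y))
              (min (μ.real {(x₀, y₀)}) (min (μ.real {(x₀, y₁)}) (μ.real {(x₁, y₀)}))) →
            CommInfo.IC μ f ε ≤ CommInfo.IC μ f 0 - τ * CommInfo.h ε) := by
  refine ⟨fun X Y Z _ _ _ _ _ _ f μ _ hIC ↦ CommInfo.exists_IC_le_sub hIC,
    ⟨fun n m ↦ CommInfo.threshold n m 1, fun n m _ ↦ CommInfo.threshold_pos n m 1, ?_⟩,
    ⟨fun n m ↦ CommInfo.threshold n m (1 / 2), fun n m _ ↦ CommInfo.threshold_pos n m _, ?_⟩⟩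
  · intro X Y Z _ _ _ _ _ _ f μ _ hIC a b ha hb hab hf
    -- The constant obtained exceeds the required one, since masses are at most 1.
    refine ⟨μ.real {b} / 2, ?_, fun ε hε0 hε ↦ CommInfo.IC_le_sub_of_ne hIC ha hb hab hf hε0 hε⟩
    have h1 : μ.real {a} ^ 2 ≤ 1 := pow_le_one₀ measureReal_nonneg measureReal_le_one
    nlinarith
  · intro X Y Z _ _ _ _ _ _ f μ _ hIC x₀ x₁ y₀ y₁ z₀ z₁ h00 _ _ h11 hz hμ00 hμ01 hμ10
    refine ⟨min (μ.real {(x₀, y₁)}) (μ.real {(x₁, y₀)}) / 4, ?_, fun ε hε0 hε ↦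
      CommInfo.IC_le_sub_of_and hIC (by rwa [h00, h11]) hμ00 hμ01 hμ10 hε0 hε⟩
    have h1 : μ.real {(x₀, y₀)} ^ 2 ≤ 1 := pow_le_one₀ measureReal_nonneg measureReal_le_one
    have h2 := lt_min hμ01 hμ10
    nlinarith
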